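/- Throughout, rings are commutative with identity. Let $R$ be a Noetherian ring and $M$ a nonzero finitely generated $R$-module. For $\mathfrak p\in\operatorname{Supp}_R M$ let $\operatorname{ht}_M\mathfrak p$ be the supremum of the lengths of chains of primes of $\operatorname{Supp}_R M$ ending at $\mathfrak p$. The Cousin complex $C(M)$ of $M$ (with respect to the $M$-height filtration) is the complex $$0\to M\xrightarrow{d^{-1}}M^0\xrightarrow{d^0}M^1\to\cdots\to M^i\xrightarrow{d^i}M^{i+1}\to\cdots$$ defined inductively by $M^{-2}=0$, $M^{-1}=M$, and, for $i\ge 0$, $$M^i=\bigoplus_{\operatorname{ht}_M\mathfrak p=i}(\operatorname{coker} d^{i-2})_{\mathfrak p},$$ where $d^{i-1}:M^{i-1}\to M^i$ sends $x$ to the element whose $\mathfrak p$-component is $\pi(x)/1$, with $\pi:M^{i-1}\to\operatorname{coker}d^{i-2}$ the canonical epimorphism. An $R$-module $N$ is Gorenstein injective if there is an exact sequence $\cdots\to E_1\to E_0\to E^0\to E^1\to\cdots$ of injective $R$-modules that stays exact under $\operatorname{Hom}_R(I,-)$ for every injective $R$-module $I$ and such that $N\cong\ker(E^0\to E^1)$.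 A nonzero finitely generated $R$-module $M$ is called Gorenstein (respectively G-Gorenstein) if $C(M)$ is exact and every $M^i$, $i\ge 0$, is injective (respectively Gorenstein injective). When $R$ is local with maximal ideal $\mathfrak m$, the depth of an $R$-module $M$ is the supremum of the lengths of $M$-regular sequences in $\mathfrak m$, and a maximal Cohen–Macaulay $R$-module is a nonzero finitely generated $R$-module $M$ with $\operatorname{depth}M=\dim M=\dim R$. **Theorem 3.11.** Let $R$ be a Gorenstein local ring (that is, a Noetherian local ring of finite injective dimension as a module over itself) which is not regular. Then the class of G-Gorenstein $R$-modules strictly contains the class of Gorenstein $R$-modules: every Gorenstein $R$-module is G-Gorenstein, and there is a G-Gorenstein $R$-module that is not Gorenstein. Moreover, such a module can be found among the maximal Cohen–Macaulay $R$-modules of infinite injective dimension: there exists a maximal Cohen–Macaulay $R$-module of infinite injective dimension which is G-Gorenstein and not Gorenstein. -/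

import Mathlib

open CategoryTheory
open scoped DirectSum

universe u

noncomputable section

/-! ### Filtrations of the spectrum -/

/-- A filtration of `Spec R`: a descending sequence `F₀ ⊇ F₁ ⊇ ⋯` of sets of primes such that each
member of `Fᵢ \ Fᵢ₊₁` is a minimal member of `Fᵢ` with respect to inclusion. -/
structure SpecFiltration (R : Type u) [CommRing R] where
  /-- the sets of the filtration -/
  carrier : ℕ → Set (PrimeSpectrum R)
  succ_subset : ∀ i, carrier (i + 1) ⊆ carrier i
  minimal : ∀ i, ∀ p ∈ carrier i \ carrier (i + 1), Minimal (· ∈ carrier i) p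

/-- `∂Fᵢ = Fᵢ \ Fᵢ₊₁`. -/
def SpecFiltration.bd {R : Type u} [CommRing R] (F : SpecFiltration R) (i : ℕ) :
    Set (PrimeSpectrum R) :=
  F.carrier i \ F.carrier (i + 1)

/-- The `M`-height of a prime `p ∈ Supp M`: the supremum of the lengths of chains
`p₀ < ⋯ < pₙ ≤ p` of primes in `Supp M`. -/
def moduleHeight (R : Type u) [CommRing R] (M : Type u) [AddCommGroup M] [Module R M]
    (p : Module.support R M) : ℕ∞ :=
  Order.height p

/-- The `M`-height filtration `Kᵢ = {p ∈ Supp M | ht_M p ≥ i}`. -/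
def heightFiltration (R : Type u) [CommRing R] (M : Type u) [AddCommGroup M] [Module R M] :
    SpecFiltration R where
  carrier i := {p | ∃ hp : p ∈ Module.support R M, (i : ℕ∞) ≤ moduleHeight R M ⟨p, hp⟩}
  succ_subset := by
    rintro i p ⟨hp, h⟩
    exact ⟨hp, le_trans (by exact_mod_cast Nat.le_succ i) h⟩
  minimal := by
    rintro i p ⟨⟨hp, h⟩, hn⟩
    refine ⟨⟨hp, h⟩, ?_⟩
    rintro q ⟨hq, h'⟩ hqp
    by_contra hpq
    refine hn ⟨hp, ?_⟩
    have hlt : (⟨q, hq⟩ : Module.support R M) < ⟨p, hp⟩ := lt_of_le_not_ge hqp hpq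
    have := Order.height_add_one_le hlt
    push_cast
    exact le_trans (add_le_add_left h' 1) this

lemma support_subset_heightFiltration (R : Type u) [CommRing R] (M : Type u) [AddCommGroup M]
    [Module R M] : Module.support R M ⊆ (heightFiltration R M).carrier 0 :=
  fun _ hp => ⟨hp, by simp⟩

/-! ### The Cousin complex -/

section Cousin

variable {R : Type u} [CommRing R]

/-- `⨁_{p ∈ A} C_p`. -/
abbrev LocSum (A : Set (PrimeSpectrum R)) (C : Type u) [AddCommGroup C] [Module R C] : Type u :=
  ⨁ p : A, LocalizedModule p.1.asIdeal.primeCompl C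

/-- The inclusion `⨁_{p ∈ A} C_p → ∏_{p ∈ A} C_p`. -/
def locSumToPi (A : Set (PrimeSpectrum R)) (C : Type u) [AddCommGroup C] [Module R C] :
    LocSum A C →ₗ[R] (∀ p : A, LocalizedModule p.1.asIdeal.primeCompl C) :=
  DirectSum.coeFnLinearMap R

lemma locSumToPi_injective (A : Set (PrimeSpectrum R)) (C : Type u) [AddCommGroup C]
    [Module R C] : Function.Injective (locSumToPi A C) :=
  DFunLike.coe_injective

lemma locSumToPi_apply (A : Set (PrimeSpectrum R)) (C : Type u) [AddCommGroup C] [Module R C]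
    (z : LocSum A C) (p : A) : locSumToPi A C z p = z p :=
  rfl

lemma localized_ne_zero_iff {C : Type u} [AddCommGroup C] [Module R C] (p : PrimeSpectrum R)
    (x : C) : LocalizedModule.mkLinearMap p.asIdeal.primeCompl C x ≠ 0 ↔
      ∀ r : R, r • x = 0 → r ∈ p.asIdeal := by
  rw [Ne, IsLocalizedModule.eq_zero_iff p.asIdeal.primeCompl]
  constructor
  · intro h r hr
    by_contra hrp
    exact h ⟨⟨r, hrp⟩, hr⟩
  · rintro h ⟨c, hc⟩
    exact c.2 (h c.1 hc)

lemma mem_support_of_annihilates {C : Type u} [AddCommGroup C] [Module R C] (p : PrimeSpectrum R)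
    (x : C) (h : ∀ r : R, r • x = 0 → r ∈ p.asIdeal) : p ∈ Module.support R C := by
  rw [Module.mem_support_iff']
  exact ⟨x, fun r hr h0 => hr (h r h0)⟩

/-- An element of a module supported in `Fᵢ` has only finitely many nonzero components in the
localizations at the primes of `∂Fᵢ`. -/
lemma finite_components [IsNoetherianRing R] (F : SpecFiltration R) (i : ℕ) (C : Type u)
    [AddCommGroup C] [Module R C] (hC : Module.support R C ⊆ F.carrier i) (x : C) :
    {p : F.bd i | LocalizedModule.mkLinearMap p.1.asIdeal.primeCompl C x ≠ 0}.Finite := by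
  let J : Ideal R := LinearMap.ker (LinearMap.toSpanSingleton R C x)
  have hJ : ∀ r : R, r ∈ J ↔ r • x = 0 := fun r => by simp [J]
  refine Set.Finite.of_finite_image (f := fun p : F.bd i => p.1.asIdeal)
    ((Ideal.finite_minimalPrimes_of_isNoetherianRing R J).subset ?_) ?_
  · rintro _ ⟨p, hp, rfl⟩
    have hp' := (localized_ne_zero_iff p.1 x).1 hp
    refine ⟨⟨p.1.2, fun r hr => hp' r ((hJ r).1 hr)⟩, ?_⟩
    rintro q ⟨hq, hJq⟩ hqp
    have hqs : (⟨q, hq⟩ : PrimeSpectrum R) ∈ F.carrier i :=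
      hC (mem_support_of_annihilates ⟨q, hq⟩ x fun r hr => hJq ((hJ r).2 hr))
    exact (F.minimal i p.1 p.2).2 hqs hqp
  · intro p _ q _ h
    exact Subtype.ext (PrimeSpectrum.ext h)

lemma localizations_mem_range [IsNoetherianRing R] (F : SpecFiltration R) (i : ℕ) (C : Type u)
    [AddCommGroup C] [Module R C] (hC : Module.support R C ⊆ F.carrier i) (x : C) :
    LinearMap.pi (fun p : F.bd i => LocalizedModule.mkLinearMap p.1.asIdeal.primeCompl C) x ∈
      LinearMap.range (locSumToPi (F.bd i) C) := by
  classical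
  refine ⟨DirectSum.mk _ (finite_components F i C hC x).toFinset
    fun p => LocalizedModule.mkLinearMap p.1.1.asIdeal.primeCompl C x, ?_⟩
  funext p
  refine (locSumToPi_apply _ _ _ p).trans ?_
  by_cases h : p ∈ (finite_components F i C hC x).toFinset
  · rw [DirectSum.mk_apply_of_mem h]
    rfl
  · rw [DirectSum.mk_apply_of_notMem h]
    have h' : ¬ (LocalizedModule.mkLinearMap p.1.asIdeal.primeCompl C x ≠ 0) :=
      fun h'' => h ((Set.Finite.mem_toFinset _).2 h'')
    exact (not_not.1 h').symm

/-- The canonical map `C → ⨁_{p ∈ ∂Fᵢ} C_p`, whose `p`-component sends `x` to `x / 1`, for a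
module `C` with `Supp C ⊆ Fᵢ`. -/
def toLocSum [IsNoetherianRing R] (F : SpecFiltration R) (i : ℕ) (C : Type u)
    [AddCommGroup C] [Module R C] (hC : Module.support R C ⊆ F.carrier i) :
    C →ₗ[R] LocSum (F.bd i) C :=
  (LinearEquiv.ofInjective (locSumToPi (F.bd i) C)
      (locSumToPi_injective _ _)).symm.toLinearMap ∘ₗ
    (LinearMap.pi
      (fun p : F.bd i => LocalizedModule.mkLinearMap p.1.asIdeal.primeCompl C)).codRestrict _
      (localizations_mem_range F i C hC)

lemma toLocSum_apply [IsNoetherianRing R] (F : SpecFiltration R) (i : ℕ) (C : Type u)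
    [AddCommGroup C] [Module R C] (hC : Module.support R C ⊆ F.carrier i) (x : C) (p : F.bd i) :
    toLocSum F i C hC x p = LocalizedModule.mk x 1 := by
  have h := (LinearEquiv.ofInjective (locSumToPi (F.bd i) C)
      (locSumToPi_injective _ _)).apply_symm_apply
      ⟨_, localizations_mem_range F i C hC x⟩
  exact congrFun (congrArg Subtype.val h) p

/-- If `p` is minimal in a set containing `Supp C`, each `t ∈ p` acts locally nilpotently on
`C_p`. -/
lemma exists_pow_smul_eq_zero {C : Type u} [AddCommGroup C] [Module R C]
    (A : Set (PrimeSpectrum R)) (hC : Module.support R C ⊆ A) (p : PrimeSpectrum R)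
    (hp : Minimal (· ∈ A) p) (t : R) (ht : t ∈ p.asIdeal)
    (y : LocalizedModule p.asIdeal.primeCompl C) : ∃ n : ℕ, t ^ n • y = 0 := by
  induction y using LocalizedModule.induction_on with
  | _ c s =>
  let J : Ideal R := LinearMap.ker (LinearMap.toSpanSingleton R C c)
  have hJ : ∀ r : R, r ∈ J ↔ r • c = 0 := fun r => by simp [J]
  have hmeet : ∃ r ∈ J, r ∈ p.asIdeal.primeCompl ⊔ Submonoid.powers t := by
    by_contra hcon
    push Not at hcon
    obtain ⟨q, hq, hJq, hdis⟩ := Ideal.exists_le_prime_disjoint J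
      (p.asIdeal.primeCompl ⊔ Submonoid.powers t) (Set.disjoint_left.2 hcon)
    have hqs : (⟨q, hq⟩ : PrimeSpectrum R) ∈ A :=
      hC (mem_support_of_annihilates ⟨q, hq⟩ c fun r hr => hJq ((hJ r).2 hr))
    have hqp : (⟨q, hq⟩ : PrimeSpectrum R) ≤ p := fun r hr => by
      by_contra hrp
      exact Set.disjoint_left.1 hdis hr
        (Submonoid.mem_sup_left (show r ∈ p.asIdeal.primeCompl from hrp))
    exact Set.disjoint_left.1 hdis (hp.2 hqs hqp ht)
      (Submonoid.mem_sup_right (Submonoid.mem_powers t))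
  obtain ⟨r, hrJ, hr⟩ := hmeet
  obtain ⟨a, ha, b, ⟨n, rfl⟩, rfl⟩ := Submonoid.mem_sup.1 hr
  refine ⟨n, ?_⟩
  rw [LocalizedModule.smul'_mk]
  have h0 : (a * t ^ n) • c = 0 := (hJ _).1 hrJ
  rw [← LocalizedModule.zero_mk s, LocalizedModule.mk_eq]
  refine ⟨⟨a, ha⟩, ?_⟩
  rw [smul_zero, smul_zero, smul_comm, Submonoid.smul_def _ (t ^ n • c), smul_smul a, h0,
    smul_zero]

/-- The cokernel of `C → ⨁_{p ∈ ∂Fᵢ} C_p` is supported in `Fᵢ₊₁`. -/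
lemma support_coker_subset [IsNoetherianRing R] (F : SpecFiltration R) (i : ℕ) (C : Type u)
    [AddCommGroup C] [Module R C] (hC : Module.support R C ⊆ F.carrier i) :
    Module.support R (LocSum (F.bd i) C ⧸ LinearMap.range (toLocSum F i C hC)) ⊆
      F.carrier (i + 1) := by
  classical
  intro q hq
  by_contra hqF
  rw [Module.mem_support_iff'] at hq
  obtain ⟨m, hm⟩ := hq
  -- the elements of the direct sum that become zero in the localized cokernel
  let N : Submodule R (LocSum (F.bd i) C) :=
    (LinearMap.ker (LocalizedModule.mkLinearMap q.asIdeal.primeCompl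
      (LocSum (F.bd i) C ⧸ LinearMap.range (toLocSum F i C hC)))).comap
      (LinearMap.range (toLocSum F i C hC)).mkQ
  have hN : ∀ z : LocSum (F.bd i) C, z ∈ N ↔
      ∃ r : R, r ∉ q.asIdeal ∧ r • z ∈ LinearMap.range (toLocSum F i C hC) := by
    intro z
    refine (IsLocalizedModule.eq_zero_iff q.asIdeal.primeCompl _
      (m := Submodule.mkQ (LinearMap.range (toLocSum F i C hC)) z)).trans ⟨?_, ?_⟩
    · rintro ⟨r, hr⟩
      exact ⟨r.1, r.2, (Submodule.Quotient.mk_eq_zero _).1 hr⟩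
    · rintro ⟨r, hr, hz⟩
      exact ⟨⟨r, hr⟩, (Submodule.Quotient.mk_eq_zero _).2 hz⟩
  have hsat : ∀ (z : LocSum (F.bd i) C) (r : R), r ∉ q.asIdeal → r • z ∈ N → z ∈ N := by
    intro z r hr hz
    obtain ⟨r', hr', hz'⟩ := (hN _).1 hz
    refine (hN _).2 ⟨r' * r, fun h => (q.2.mem_or_mem h).elim hr' hr, ?_⟩
    rwa [mul_smul]
  have hkill : ∀ (p : F.bd i) (y : LocalizedModule p.1.asIdeal.primeCompl C) (r : R),
      r ∉ q.asIdeal → r • y = 0 → (DirectSum.of _ p y : LocSum (F.bd i) C) ∈ N := by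
    intro p y r hr hy
    refine hsat _ r hr ?_
    change r • (DirectSum.lof R (F.bd i)
      (fun p => LocalizedModule p.1.asIdeal.primeCompl C) p y) ∈ N
    rw [← map_smul, hy, map_zero]
    exact N.zero_mem
  have hne : ∀ (p : F.bd i) (y : LocalizedModule p.1.asIdeal.primeCompl C),
      ¬ p.1.asIdeal ≤ q.asIdeal → (DirectSum.of _ p y : LocSum (F.bd i) C) ∈ N := by
    intro p y hpq
    obtain ⟨t, htp, htq⟩ := Set.not_subset.1 hpq
    obtain ⟨n, hn⟩ := exists_pow_smul_eq_zero _ hC p.1 (F.minimal i p.1 p.2) t htp y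
    exact hkill p y (t ^ n) (fun h => htq (q.2.mem_of_pow_mem n h)) hn
  suffices hall : ∀ z : LocSum (F.bd i) C, z ∈ N by
    obtain ⟨z, rfl⟩ := Submodule.mkQ_surjective _ m
    obtain ⟨r, hr, hz⟩ := (hN z).1 (hall z)
    exact hm r hr ((Submodule.Quotient.mk_eq_zero _).2 hz)
  intro z
  induction z using DirectSum.induction_on with
  | zero => exact N.zero_mem
  | add x y hx hy => exact N.add_mem hx hy
  | of p y =>
    by_cases hpq : p.1.asIdeal ≤ q.asIdeal
    · by_cases hqi : q ∈ F.carrier i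
      · have hpq' : p.1 = q := le_antisymm hpq ((F.minimal i q ⟨hqi, hqF⟩).2 p.2.1 hpq)
        induction y using LocalizedModule.induction_on with
        | _ c s =>
        refine hsat _ s.1 (hpq' ▸ s.2) ?_
        have hsy : s.1 • LocalizedModule.mk c s = LocalizedModule.mk c 1 :=
          (LocalizedModule.smul'_mk (S := p.1.asIdeal.primeCompl) _ _ _).trans (LocalizedModule.mk_cancel s c)
        change s.1 • (DirectSum.lof R (F.bd i)
          (fun p => LocalizedModule p.1.asIdeal.primeCompl C) p (LocalizedModule.mk c s)) ∈ N
        rw [← map_smul, hsy]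
        have hc : toLocSum F i C hC c ∈ N :=
          (hN _).2 ⟨1, q.1.ne_top_iff_one.1 q.2.ne_top, by rw [one_smul]; exact ⟨c, rfl⟩⟩
        rw [← DirectSum.sum_support_of (toLocSum F i C hC c)] at hc
        have hrest : ∀ p' : F.bd i, p' ≠ p →
            (DirectSum.of _ p' (toLocSum F i C hC c p') : LocSum (F.bd i) C) ∈ N := by
          intro p' hp'
          refine hne p' _ fun hle => hp' (Subtype.ext ?_)
          have hmin := F.minimal i p.1 p.2
          exact le_antisymm (hpq' ▸ hle) (hmin.2 p'.2.1 (hpq' ▸ hle))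
        rw [← toLocSum_apply F i C hC c p]
        by_cases hps : p ∈ DFinsupp.support (toLocSum F i C hC c)
        · rw [← Finset.add_sum_erase _ _ hps] at hc
          exact (Submodule.add_mem_iff_left N
            (N.sum_mem fun p' hp' => hrest p' (Finset.ne_of_mem_erase hp'))).1 hc
        · rw [DFinsupp.notMem_support_iff.1 hps, map_zero]
          exact N.zero_mem
      · have hex : ∃ r : R, r ∉ q.asIdeal ∧ r • y = 0 := by
          induction y using LocalizedModule.induction_on with
          | _ c s =>
          by_contra hcon
          refine hqi (hC (mem_support_of_annihilates q c fun r hr => ?_))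
          by_contra hrq
          refine hcon ⟨r, hrq, ?_⟩
          rw [LocalizedModule.smul'_mk, hr, LocalizedModule.zero_mk]
        obtain ⟨r, hr, hry⟩ := hex
        exact hkill p y r hr hry
    · exact hne p y hpq

variable [IsNoetherianRing R]

/-- The modules `coker d^{i-2}` of the Cousin complex `C(F, M)` of a module `M` with
`Supp M ⊆ F₀`, together with the fact that they are supported in `Fᵢ`. With `M^{-2} = 0` and
`M^{-1} = M` one has `coker d^{-2} = M`. For `i ≥ 0` the differential `d^{i-1} : M^{i-1} → M^i` is
the composite of the surjection `M^{i-1} → coker d^{i-2}` with the canonical map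
`coker d^{i-2} → ⨁_{p ∈ ∂Fᵢ} (coker d^{i-2})_p = M^i`, so the images of `d^{i-1}` and of this
canonical map coincide, and `coker d^{i-1}` is the cokernel of the canonical map. -/
def cousinCokerAux (F : SpecFiltration R) (M : Type u) [AddCommGroup M] [Module R M]
    (hM : Module.support R M ⊆ F.carrier 0) :
    (i : ℕ) → {C : ModuleCat.{u} R // Module.support R C ⊆ F.carrier i}
  | 0 => ⟨ModuleCat.of R M, hM⟩
  | i + 1 =>
    let C := cousinCokerAux F M hM i
    ⟨ModuleCat.of R (LocSum (F.bd i) C.1 ⧸ LinearMap.range (toLocSum F i C.1 C.2)),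
      support_coker_subset F i C.1 C.2⟩

variable (F : SpecFiltration R) (M : Type u) [AddCommGroup M] [Module R M]
  (hM : Module.support R M ⊆ F.carrier 0)

/-- `coker d^{i-2}`. -/
def cousinCoker (i : ℕ) : ModuleCat.{u} R := (cousinCokerAux F M hM i).1

lemma support_cousinCoker_subset (i : ℕ) :
    Module.support R (cousinCoker F M hM i) ⊆ F.carrier i :=
  (cousinCokerAux F M hM i).2

/-- The term `M^i = ⨁_{p ∈ ∂Fᵢ} (coker d^{i-2})_p` of the Cousin complex. -/
def cousinTerm (i : ℕ) : ModuleCat.{u} R :=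
  ModuleCat.of R (LocSum (F.bd i) (cousinCoker F M hM i))

/-- The canonical map `coker d^{i-2} → M^i`. -/
def cousinCokerToTerm (i : ℕ) : cousinCoker F M hM i →ₗ[R] cousinTerm F M hM i :=
  toLocSum F i _ (support_cousinCoker_subset F M hM i)

/-- The canonical epimorphism `M^i → coker d^{i-1}`. -/
def cousinProj (i : ℕ) : cousinTerm F M hM i →ₗ[R] cousinCoker F M hM (i + 1) :=
  (LinearMap.range (cousinCokerToTerm F M hM i)).mkQ

/-- The augmentation `d^{-1} : M → M^0`. -/
def cousinAug : M →ₗ[R] cousinTerm F M hM 0 := cousinCokerToTerm F M hM 0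

/-- The differential `d^i : M^i → M^{i+1}`. -/
def cousinD (i : ℕ) : cousinTerm F M hM i →ₗ[R] cousinTerm F M hM (i + 1) :=
  cousinCokerToTerm F M hM (i + 1) ∘ₗ cousinProj F M hM i

lemma cousinProj_surjective (i : ℕ) : Function.Surjective (cousinProj F M hM i) :=
  Submodule.mkQ_surjective _

lemma ker_cousinProj_zero :
    LinearMap.ker (cousinProj F M hM 0) = LinearMap.range (cousinAug F M hM) :=
  Submodule.ker_mkQ _

lemma ker_cousinProj_succ (i : ℕ) :
    LinearMap.ker (cousinProj F M hM (i + 1)) = LinearMap.range (cousinD F M hM i) := by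
  refine (Submodule.ker_mkQ _).trans ?_
  rw [cousinD, LinearMap.range_comp_of_range_eq_top _
    (LinearMap.range_eq_top.2 (cousinProj_surjective F M hM i))]

/-- The sequence `0 → M → M^0 → M^1 → ⋯` given by the Cousin complex `C(F, M)` is exact. -/
def CousinExact : Prop :=
  Function.Injective (cousinAug F M hM) ∧
    Function.Exact (cousinAug F M hM) (cousinD F M hM 0) ∧
    ∀ i, Function.Exact (cousinD F M hM i) (cousinD F M hM (i + 1))

end Cousin

/-! ### Gorenstein injective modules, Gorenstein and G-Gorenstein modules -/

/-- `N` is Gorenstein injective: there is an exact complex `E` of injective modules, indexed by `ℤ`,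
which stays exact under `Hom(I, -)` for every injective module `I`, such that
`N ≅ Ker (E⁰ → E¹)`. -/
def IsGorensteinInjective (R : Type u) [CommRing R] (N : ModuleCat.{u} R) : Prop :=
  ∃ E : CochainComplex (ModuleCat.{u} R) ℤ,
    (∀ n, Module.Injective R (E.X n)) ∧
    (∀ n, Function.Exact (E.d n (n + 1)).hom (E.d (n + 1) (n + 1 + 1)).hom) ∧
    (∀ I : ModuleCat.{u} R, Module.Injective R I → ∀ n,
      Function.Exact (fun f : I →ₗ[R] E.X n => (E.d n (n + 1)).hom ∘ₗ f)
        (fun f : I →ₗ[R] E.X (n + 1) => (E.d (n + 1) (n + 1 + 1)).hom ∘ₗ f)) ∧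
    Nonempty (N ≃ₗ[R] LinearMap.ker (E.d 0 1).hom)

/-- A nonzero finitely generated module `M` is Gorenstein if its Cousin complex with respect to the
`M`-height filtration is an injective resolution of `M`. -/
structure IsGorensteinModule (R : Type u) [CommRing R] [IsNoetherianRing R]
    (M : ModuleCat.{u} R) : Prop where
  finite : Module.Finite R M
  nontrivial : Nontrivial M
  exact : CousinExact (heightFiltration R M) M (support_subset_heightFiltration R M)
  injective : ∀ i, Module.Injective R
    (cousinTerm (heightFiltration R M) M (support_subset_heightFiltration R M) i)

/-- A nonzero finitely generated module `M` is G-Gorenstein if its Cousin complex with respect to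
the `M`-height filtration is a Gorenstein injective resolution of `M`. -/
structure IsGGorensteinModule (R : Type u) [CommRing R] [IsNoetherianRing R]
    (M : ModuleCat.{u} R) : Prop where
  finite : Module.Finite R M
  nontrivial : Nontrivial M
  exact : CousinExact (heightFiltration R M) M (support_subset_heightFiltration R M)
  gorensteinInjective : ∀ i, IsGorensteinInjective R
    (cousinTerm (heightFiltration R M) M (support_subset_heightFiltration R M) i)

/-! ### Gorenstein local rings and maximal Cohen-Macaulay modules -/

/-- A Gorenstein local ring: a Noetherian local ring of finite injective dimension over itself. -/
class IsGorensteinLocalRing (R : Type u) [CommRing R] : Prop extends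
    IsLocalRing R, IsNoetherianRing R where
  injectiveDimension_lt_top : injectiveDimension (ModuleCat.of R R) < ⊤

/-- The depth of a module over a local ring: the supremum of the lengths of `M`-regular sequences in
the maximal ideal. -/
def moduleDepth (R : Type u) [CommRing R] [IsLocalRing R] (M : ModuleCat.{u} R) : ℕ∞ :=
  ⨆ rs : {rs : List R // (∀ r ∈ rs, r ∈ IsLocalRing.maximalIdeal R) ∧
    RingTheory.Sequence.IsRegular M rs}, (rs.1.length : ℕ∞)

/-- A maximal Cohen-Macaulay module over a local ring: a nonzero finitely generated module `M` with
`depth M = dim M = dim R`. -/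
structure IsMaximalCohenMacaulay (R : Type u) [CommRing R] [IsLocalRing R]
    (M : ModuleCat.{u} R) : Prop where
  finite : Module.Finite R M
  nontrivial : Nontrivial M
  depth_eq : (moduleDepth R M : WithBot ℕ∞) = Module.supportDim R M
  dim_eq : Module.supportDim R M = ringKrullDim R

end

/-! The inclusion of classes holds because an injective module is Gorenstein injective, through a
contractible complex. Strictness needs one module. It is `M = P.cocycles`, the degree-zero cocycles
of a complete resolution `P`: an exact complex of finite free modules, unbounded in both directions,
whose dual is exact too.

The ring comes first. Over a Gorenstein local ring `Ext^j(R/p, R)_p` vanishes for `j ≠ ht p`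
(`extTorsion_of_height_lt`, `subsingleton_ext_of_lt_height`). Dimension shifting along the Cousin
complex of `R` then shows that it is exact with injective terms (`cousinCoker_ext`). It is bounded,
since heights are bounded by the dimension.

Localization, direct sums and cokernels commute with `- ⊗ M`, and if `M` has full support its height
filtration is that of `R`; hence `C(M) = C(R) ⊗ M` (`exists_cousin_tensor`). On an injective module
`E` the complex `E ⊗ P` is `Hom(P*, E)`, so it is exact. Descending from the end of `C(R)`, `P`
stays exact on every cosyzygy of `C(R)`, so tensoring with `M` preserves the injections that make up
the exactness of `C(R)`. Each term `E ⊗ M` of `C(M)` is the kernel in degree `0` of `E ⊗ P`, which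
is a complex of injectives; `Hom(I, E ⊗ P) = Hom(I ⊗ P*, E)` is exact for injective `I`. So `M` is
G-Gorenstein (`cousin_cocycles`).

To obtain infinite injective dimension, `P` is spliced from a free resolution of the residue field
`k`, so that `M` is a high syzygy of `k`. If `M` had finite injective dimension, then `Ext^j(k, M) =
0` for large `j`. Since `R` has finite injective dimension, shifting down the resolution gives
`Ext^j(k, k) = 0` for some `j`, and then `R` is regular (`isRegularLocalRing_of_subsingleton_ext`, a
form of Serre's theorem). A Gorenstein module of full support has a bounded injective resolution,
its Cousin complex, so `M` is not Gorenstein. It is maximal Cohen–Macaulay because `Ext^j(k, -)`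
below the dimension vanishes on `R`, hence on cocycles. -/

noncomputable section

open Abelian
open scoped TensorProduct

/-! ### Torsion of `Ext` modules -/

section ExtTorsion

variable {R : Type u} [CommRing R]

/-- The module `Ext^j(X, N)` becomes zero after localization at `S`. -/
def ExtTorsion (S : Submonoid R) (X N : ModuleCat.{u} R) (j : ℕ) : Prop :=
  ∀ e : Ext X N j, ∃ s ∈ S, s • e = 0

lemma extTorsion_of_subsingleton {S : Submonoid R} {X N : ModuleCat.{u} R} {j : ℕ}
    (h : Subsingleton (Ext X N j)) : ExtTorsion S X N j :=
  fun _ => ⟨1, S.one_mem, Subsingleton.elim _ _⟩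

/-- Because of the case `S = ⊥`, the long exact sequence arguments below are written once for
torsion and serve for plain vanishing as well. -/
lemma extTorsion_bot_iff {X N : ModuleCat.{u} R} {j : ℕ} :
    ExtTorsion ⊥ X N j ↔ Subsingleton (Ext X N j) := by
  refine ⟨fun h => ⟨fun a b => ?_⟩, extTorsion_of_subsingleton⟩
  have h0 : ∀ e : Ext X N j, e = 0 := fun e => by
    obtain ⟨s, hs, h⟩ := h e
    rwa [Submonoid.mem_bot.1 hs, one_smul] at h
  rw [h0 a, h0 b]

lemma ExtTorsion.mono {S T : Submonoid R} (hST : S ≤ T) {X N : ModuleCat.{u} R} {j : ℕ}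
    (h : ExtTorsion S X N j) : ExtTorsion T X N j := fun e =>
  let ⟨s, hs, h⟩ := h e
  ⟨s, hST hs, h⟩

lemma ExtTorsion.of_linearEquiv {S : Submonoid R} {X Y N : ModuleCat.{u} R} {j : ℕ}
    (h : ExtTorsion S X N j) (f : X ≃ₗ[R] Y) : ExtTorsion S Y N j := by
  intro e
  obtain ⟨s, hs, h⟩ := h ((Ext.mk₀ f.toModuleIso.hom).comp e (zero_add j))
  refine ⟨s, hs, ?_⟩
  rw [← Ext.comp_smul] at h
  have := congrArg (fun t => (Ext.mk₀ f.toModuleIso.inv).comp t (zero_add j)) h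
  simpa only [Ext.mk₀_comp_mk₀_assoc, Iso.inv_hom_id, Ext.mk₀_id_comp, Ext.comp_zero] using this

lemma ext_smul_eq_mk₀_smul_comp {X N : ModuleCat.{u} R} {j : ℕ} (r : R) (e : Ext X N j) :
    r • e = (Ext.mk₀ (r • 𝟙 X)).comp e (zero_add j) := by
  rw [Ext.mk₀_smul, Ext.smul_comp, Ext.mk₀_id_comp]

lemma extTorsion_of_mem_annihilator {S : Submonoid R} {X N : ModuleCat.{u} R} {j : ℕ} {s : R}
    (hs : s ∈ S) (h : s ∈ Module.annihilator R X) : ExtTorsion S X N j := by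
  refine fun e => ⟨s, hs, ?_⟩
  have h0 : s • 𝟙 X = 0 := by
    ext x
    exact Module.mem_annihilator.1 h x
  rw [ext_smul_eq_mk₀_smul_comp, h0, Ext.mk₀_zero, Ext.zero_comp]

variable {A B C : Type u} [AddCommGroup A] [AddCommGroup B] [AddCommGroup C] [Module R A]
  [Module R B] [Module R C]

/-- The short complex of modules attached to an exact pair of linear maps. -/
abbrev exactComplex (f : A →ₗ[R] B) (g : B →ₗ[R] C) (h : Function.Exact f g) :
    ShortComplex (ModuleCat.{u} R) :=
  ModuleCat.shortComplexOfCompEqZero f g h.linearMap_comp_eq_zero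

lemma exactComplex_shortExact {f : A →ₗ[R] B} {g : B →ₗ[R] C} (h : Function.Exact f g)
    (hf : Function.Injective f) (hg : Function.Surjective g) : (exactComplex f g h).ShortExact :=
  ModuleCat.shortComplex_shortExact _ h hf hg

section contravariant

variable {S : Submonoid R} {N : ModuleCat.{u} R} {j : ℕ} {T : ShortComplex (ModuleCat.{u} R)}
  (hT : T.ShortExact)

include hT

/-- In the long exact sequence some multiple `s • e` maps to zero, hence lifts; the lift is killed
by some `t`, so `t * s` kills `e`. The four lemmas that follow are the same argument at other places
of the two long exact sequences. -/
lemma ExtTorsion.middle_left (h₁ : ExtTorsion S T.X₁ N j) (h₃ : ExtTorsion S T.X₃ N j) :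
    ExtTorsion S T.X₂ N j := by
  intro e
  obtain ⟨s, hs, h⟩ := h₁ ((Ext.mk₀ T.f).comp e (zero_add j))
  rw [← Ext.comp_smul] at h
  obtain ⟨e', he'⟩ := Ext.contravariant_sequence_exact₂ hT _ _ h
  obtain ⟨t, ht, h'⟩ := h₃ e'
  refine ⟨t * s, S.mul_mem ht hs, ?_⟩
  rw [mul_smul, ← he', ← Ext.comp_smul, h', Ext.comp_zero]

lemma ExtTorsion.left_of_succ (h₂ : ExtTorsion S T.X₂ N j) (h₃ : ExtTorsion S T.X₃ N (j + 1)) :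
    ExtTorsion S T.X₁ N j := by
  intro e
  obtain ⟨s, hs, h⟩ := h₃ (hT.extClass.comp e (add_comm 1 j))
  rw [← Ext.comp_smul] at h
  obtain ⟨e', he'⟩ := Ext.contravariant_sequence_exact₁ hT _ _ _ h
  obtain ⟨t, ht, h'⟩ := h₂ e'
  refine ⟨t * s, S.mul_mem ht hs, ?_⟩
  rw [mul_smul, ← he', ← Ext.comp_smul, h', Ext.comp_zero]

end contravariant

section covariant

variable {S : Submonoid R} {X : ModuleCat.{u} R} {j : ℕ} {T : ShortComplex (ModuleCat.{u} R)}
  (hT : T.ShortExact)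

include hT

lemma ExtTorsion.right_of_succ (h₁ : ExtTorsion S X T.X₁ (j + 1)) (h₂ : ExtTorsion S X T.X₂ j) :
    ExtTorsion S X T.X₃ j := by
  intro e
  obtain ⟨s, hs, h⟩ := h₁ (e.comp hT.extClass rfl)
  rw [← Ext.smul_comp] at h
  obtain ⟨e', he'⟩ := Ext.covariant_sequence_exact₃ _ hT _ _ h
  obtain ⟨t, ht, h'⟩ := h₂ e'
  refine ⟨t * s, S.mul_mem ht hs, ?_⟩
  rw [mul_smul, ← he', ← Ext.smul_comp, h', Ext.zero_comp]

lemma ExtTorsion.middle_right (h₁ : ExtTorsion S X T.X₁ j) (h₃ : ExtTorsion S X T.X₃ j) :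
    ExtTorsion S X T.X₂ j := by
  intro e
  obtain ⟨s, hs, h⟩ := h₃ (e.comp (Ext.mk₀ T.g) (add_zero j))
  rw [← Ext.smul_comp] at h
  obtain ⟨e', he'⟩ := Ext.covariant_sequence_exact₂ _ hT _ h
  obtain ⟨t, ht, h'⟩ := h₁ e'
  refine ⟨t * s, S.mul_mem ht hs, ?_⟩
  rw [mul_smul, ← he', ← Ext.smul_comp, h', Ext.zero_comp]

lemma ExtTorsion.left_succ (h₃ : ExtTorsion S X T.X₃ j) (h₂ : ExtTorsion S X T.X₂ (j + 1)) :
    ExtTorsion S X T.X₁ (j + 1) := by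
  intro e
  obtain ⟨s, hs, h⟩ := h₂ (e.comp (Ext.mk₀ T.f) (add_zero _))
  rw [← Ext.smul_comp] at h
  obtain ⟨e', he'⟩ := Ext.covariant_sequence_exact₁ _ hT _ h rfl
  obtain ⟨t, ht, h'⟩ := h₃ e'
  refine ⟨t * s, S.mul_mem ht hs, ?_⟩
  rw [mul_smul, ← he', ← Ext.smul_comp, h', Ext.zero_comp]

end covariant

/-- `Ext^j(X, N)` is `S`-torsion as soon as `Ext^j(R/q, N)` is for all primes `q` in the support of
the finitely generated module `X`. -/
lemma extTorsion_of_forall_prime [IsNoetherianRing R] {S : Submonoid R} {N : ModuleCat.{u} R}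
    {j : ℕ} (X : ModuleCat.{u} R) [hX : Module.Finite R X]
    (h : ∀ q : PrimeSpectrum R, q ∈ Module.support R X →
      ExtTorsion S (ModuleCat.of R (R ⧸ q.asIdeal)) N j) : ExtTorsion S X N j := by
  suffices key : ∀ (M : Type u) [AddCommGroup M] [Module R M] (_ : Module.Finite R M),
      (∀ q : PrimeSpectrum R, q ∈ Module.support R M →
        ExtTorsion S (ModuleCat.of R (R ⧸ q.asIdeal)) N j) →
      ExtTorsion S (ModuleCat.of R M) N j from key X hX h
  intro M _ _ hM
  induction hM using IsNoetherianRing.induction_on_isQuotientEquivQuotientPrime R with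
  | subsingleton M =>
    intro _
    refine extTorsion_of_mem_annihilator S.one_mem (Module.mem_annihilator.2 fun m => ?_)
    exact Subsingleton.elim (α := M) _ _
  | quotient M p f =>
    intro h
    refine (h p ?_).of_linearEquiv (X := ModuleCat.of R (R ⧸ p.asIdeal)) (Y := ModuleCat.of R M)
      f.symm
    rw [f.support_eq, Module.support_eq_zeroLocus, Ideal.annihilator_quotient]
    exact fun _ h => h
  | exact M₁ M₂ M₃ f g hf hg hfg h₁ h₃ =>
    intro h
    exact ExtTorsion.middle_left (exactComplex_shortExact hfg hf hg)
      (h₁ fun q hq => h q (Module.support_subset_of_injective f hf hq))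
      (h₃ fun q hq => h q (Module.support_subset_of_surjective g hg hq))

/-- A form of Nakayama's lemma: a finitely generated module `E` with `E_p = x E_p` for some `x ∈ p`
has `E_p = 0`. -/
lemma exists_smul_eq_zero_of_smul_mem {E : Type*} [AddCommGroup E] [Module R E]
    [Module.Finite R E] (p : Ideal R) [p.IsPrime] (x : R) (hx : x ∈ p)
    (h : ∀ e : E, ∃ s ∈ p.primeCompl, ∃ e' : E, s • e = x • e') (e : E) :
    ∃ s ∈ p.primeCompl, s • e = 0 := by
  let f := LocalizedModule.mkLinearMap p.primeCompl E
  have hfin : Module.Finite (Localization.AtPrime p) (LocalizedModule p.primeCompl E) :=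
    Module.Finite.of_isLocalizedModule p.primeCompl f
  have htop : (⊤ : Submodule (Localization.AtPrime p) (LocalizedModule p.primeCompl E)) ≤
      IsLocalRing.maximalIdeal (Localization.AtPrime p) • ⊤ := by
    rintro y -
    induction y using LocalizedModule.induction_on with
    | _ c s =>
    obtain ⟨t, ht, e', he⟩ := h c
    have : LocalizedModule.mk c s =
        algebraMap R (Localization.AtPrime p) x • LocalizedModule.mk e' (⟨t, ht⟩ * s) := by
      rw [algebraMap_smul, LocalizedModule.smul'_mk, LocalizedModule.mk_eq]
      refine ⟨1, ?_⟩
      simp only [one_smul, Submonoid.smul_def, Submonoid.coe_mul] at he ⊢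
      rw [← he, smul_smul, mul_comm]
    rw [this]
    refine Submodule.smul_mem_smul ?_ trivial
    exact (IsLocalization.AtPrime.to_map_mem_maximal_iff _ p x).2 hx
  have hbot := Submodule.eq_bot_of_le_smul_of_le_jacobson_bot _ _ Module.Finite.fg_top htop
    (IsLocalRing.maximalIdeal_le_jacobson _)
  have hfe : f e = 0 := (Submodule.mem_bot _).1 (hbot ▸ Submodule.mem_top)
  obtain ⟨s, hs⟩ := (IsLocalizedModule.eq_zero_iff p.primeCompl f).1 hfe
  exact ⟨s.1, s.2, hs⟩

end ExtTorsion

/-! ### Bass numbers of a Gorenstein local ring -/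

section AssociatedPrime

variable {R : Type u} [CommRing R] {M : Type*} [AddCommGroup M] [Module R M]

lemma IsAssociatedPrime.exists_smul_eq_zero_iff [IsNoetherianRing R] {p : Ideal R}
    (hp : IsAssociatedPrime p M) : ∃ x : M, ∀ r : R, r • x = 0 ↔ r ∈ p := by
  obtain ⟨-, x, rfl⟩ := Submodule.isAssociatedPrime_iff.1 hp
  exact ⟨x, fun r => by simp [Submodule.mem_colon_singleton]⟩

/-- The map `R/I → M` sending `1` to an element `x` killed by `I`. -/
def quotientToSpan (I : Ideal R) (x : M) (h : ∀ r ∈ I, r • x = 0) : (R ⧸ I) →ₗ[R] M :=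
  Submodule.liftQ I (LinearMap.toSpanSingleton R M x) fun r hr => by simpa using h r hr

@[simp]
lemma quotientToSpan_mk (I : Ideal R) (x : M) (h : ∀ r ∈ I, r • x = 0) (r : R) :
    quotientToSpan I x h (Ideal.Quotient.mk I r) = r • x :=
  rfl

lemma quotientToSpan_injective (I : Ideal R) (x : M) (h : ∀ r : R, r • x = 0 ↔ r ∈ I) :
    Function.Injective (quotientToSpan I x fun r hr => (h r).2 hr) := by
  rw [injective_iff_map_eq_zero]
  intro y hy
  obtain ⟨r, rfl⟩ := Ideal.Quotient.mk_surjective y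
  rw [quotientToSpan_mk, h] at hy
  exact Ideal.Quotient.eq_zero_iff_mem.2 hy

end AssociatedPrime

section Bass

variable {R : Type u} [CommRing R] {N : ModuleCat.{u} R}

lemma extTorsion_quotient_of_not_le (p q : PrimeSpectrum R) (h : ¬ q ≤ p) (j : ℕ) :
    ExtTorsion p.asIdeal.primeCompl (ModuleCat.of R (R ⧸ q.asIdeal)) N j := by
  obtain ⟨r, hrq, hrp⟩ := Set.not_subset.1 h
  refine extTorsion_of_mem_annihilator (s := r) hrp ?_
  change r ∈ Module.annihilator R (R ⧸ q.asIdeal)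
  rwa [Ideal.annihilator_quotient]

/-- Multiplication by `x ∉ q` on `R/q` has cokernel supported in the primes strictly containing
`q`. -/
lemma lt_of_mem_support_quotSMulTop {q q' : PrimeSpectrum R} {x : R} (hx : x ∉ q.asIdeal)
    (h : q' ∈ Module.support R (QuotSMulTop x (R ⧸ q.asIdeal))) : q < q' := by
  rw [Module.support_quotSMulTop, Module.support_eq_zeroLocus, Ideal.annihilator_quotient] at h
  refine lt_of_le_of_ne h.1 ?_
  rintro rfl
  exact hx (h.2 rfl)

lemma isSMulRegular_quotient_prime (q : PrimeSpectrum R) {x : R} (hx : x ∉ q.asIdeal) :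
    IsSMulRegular (R ⧸ q.asIdeal) x := by
  refine (isSMulRegular_quotient_iff_mem_of_smul_mem _ _).2 fun y hy => ?_
  exact (q.2.mem_or_mem hy).resolve_left hx

variable [IsNoetherianRing R]

/-- Bass's lemma: if `q < p` and `Ext^{j+1}(R/q', N)_p = 0` for all primes `q < q' ≤ p`, then
`Ext^j(R/q, N)_p = 0`. -/
lemma extTorsion_of_forall_lt [Module.Finite R N] {p q : PrimeSpectrum R} (hqp : q < p) (j : ℕ)
    (h : ∀ q' : PrimeSpectrum R, q < q' → q' ≤ p →
      ExtTorsion p.asIdeal.primeCompl (ModuleCat.of R (R ⧸ q'.asIdeal)) N (j + 1)) :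
    ExtTorsion p.asIdeal.primeCompl (ModuleCat.of R (R ⧸ q.asIdeal)) N j := by
  -- Multiplication by `x ∈ p \ q` on `R/q` is injective with cokernel supported strictly above `q`,
  -- so `Ext^{j+1}` of the cokernel dies at `p`. Hence `x` acts surjectively on the finitely
  -- generated module `Ext^j(R/q, N)` localized at `p`, and Nakayama applies.
  obtain ⟨x, hxp, hxq⟩ := Set.not_subset.1 hqp.not_ge
  have hreg := isSMulRegular_quotient_prime q hxq
  let X := ModuleCat.of R (R ⧸ q.asIdeal)
  have hS : (X.smulShortComplex x).ShortExact := hreg.smulShortComplex_shortExact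
  have hq : ExtTorsion p.asIdeal.primeCompl (X.smulShortComplex x).X₃ N (j + 1) := by
    refine extTorsion_of_forall_prime (ModuleCat.of R (QuotSMulTop x X)) fun q' hq' => ?_
    by_cases hle : q' ≤ p
    · exact h q' (lt_of_mem_support_quotSMulTop hxq hq') hle
    · exact extTorsion_quotient_of_not_le p q' hle _
  refine exists_smul_eq_zero_of_smul_mem p.asIdeal x hxp
    fun (e : Ext (X.smulShortComplex x).X₁ N j) => ?_
  obtain ⟨s, hs, h0⟩ := hq (hS.extClass.comp e (add_comm 1 j))
  rw [← Ext.comp_smul] at h0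
  obtain ⟨e', he'⟩ := Ext.contravariant_sequence_exact₁ hS _ _ _ h0
  refine ⟨s, hs, e', ?_⟩
  exact he'.symm.trans (ext_smul_eq_mk₀_smul_comp x e').symm

/-- If `Ext^j(R/p, N)_p = 0` for all `j > e`, then `Ext^j(X, N)_p = 0` for all `j > e` and all
finitely generated `X`. -/
lemma extTorsion_of_lt [Module.Finite R N] (p : PrimeSpectrum R) (e : ℕ)
    (h : ∀ j, e < j → ExtTorsion p.asIdeal.primeCompl (ModuleCat.of R (R ⧸ p.asIdeal)) N j)
    (X : ModuleCat.{u} R) [Module.Finite R X] (j : ℕ) (hj : e < j) :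
    ExtTorsion p.asIdeal.primeCompl X N j := by
  refine extTorsion_of_forall_prime X fun q hq => ?_
  clear hq
  have : WellFoundedGT (PrimeSpectrum R) :=
    StrictMono.wellFoundedGT (f := PrimeSpectrum.asIdeal) fun _ _ h => h
  -- Induction from large primes downwards. Each use of Bass's lemma raises the degree by one, which
  -- stays inside the range `j > e`.
  induction q using WellFoundedGT.induction generalizing j with
  | ind q ih =>
  by_cases hqp : q ≤ p
  · rcases hqp.eq_or_lt with rfl | hlt
    · exact h j hj
    · exact extTorsion_of_forall_lt hlt j fun q' hq' _ => ih q' hq' (j + 1) (by lia)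
  · exact extTorsion_quotient_of_not_le p q hqp j

/-- `Ext^h(R/p, R)_p ≠ 0` for `h` the height of `p`. -/
lemma not_extTorsion_height (n : ℕ) : ∀ p : PrimeSpectrum R, Order.height p = n →
    ¬ ExtTorsion p.asIdeal.primeCompl (ModuleCat.of R (R ⧸ p.asIdeal)) (ModuleCat.of R R) n := by
  induction n with
  -- A minimal prime is associated, so `R/p` embeds in `R`; no element outside `p` kills this
  -- embedding.
  | zero =>
    intro p hp h
    have hmin : p.asIdeal ∈ (Module.annihilator R R).minimalPrimes := by
      have : p.asIdeal ∈ minimalPrimes R := by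
        rw [← Ideal.height_eq_zero_iff, PrimeSpectrum.height_eq_orderHeight, hp, Nat.cast_zero]
      simpa [minimalPrimes, Module.annihilator_eq_bot.2 (inferInstance : FaithfulSMul R R)]
        using this
    obtain ⟨a, ha⟩ :=
      (Module.associatedPrimes.minimalPrimes_annihilator_subset_associatedPrimes R R hmin :
      IsAssociatedPrime p.asIdeal R).exists_smul_eq_zero_iff
    obtain ⟨s, hs, h0⟩ := h (Ext.mk₀ (ModuleCat.ofHom
      (quotientToSpan p.asIdeal a fun r hr => (ha r).2 hr)))
    rw [← Ext.mk₀_smul, Ext.mk₀_eq_zero_iff] at h0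
    have h1 := congrArg (fun f => f.hom (Ideal.Quotient.mk p.asIdeal 1)) h0
    change s • quotientToSpan p.asIdeal a (fun r hr => (ha r).2 hr)
      (Ideal.Quotient.mk p.asIdeal 1) = 0 at h1
    rw [quotientToSpan_mk, one_smul, ha] at h1
    exact hs h1
  | succ n ih =>
    intro p hp h
    obtain ⟨-, ⟨q, hqp, hq⟩, hle⟩ := Order.height_eq_coe_add_one_iff.1 (by exact_mod_cast hp)
    -- Here `q < p` has height `n`, and heights leave no prime strictly between them. Bass's lemma
    -- therefore needs only `Ext^{n+1}(R/p, R)_p = 0` to give `Ext^n(R/q, R)_p = 0`, which localizes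
    -- further to `q`.
    refine ih q hq ?_
    refine ExtTorsion.mono (S := p.asIdeal.primeCompl) (T := q.asIdeal.primeCompl)
      (fun s hs hsq => hs (hqp.le hsq))
      (extTorsion_of_forall_lt hqp n fun q' hq' hq'p => ?_)
    rcases hq'p.eq_or_lt with rfl | hlt
    · exact h
    · have h1 := Order.height_add_one_le hq'
      have h2 := hle q' hlt
      rw [hq] at h1
      exact absurd (h1.trans h2) (by norm_cast; lia)

/-- A regular sequence in a prime `p` has length at most the height of `p`. -/
lemma length_le_height_of_isWeaklyRegular (p : PrimeSpectrum R) (rs : List R)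
    (hrs : RingTheory.Sequence.IsWeaklyRegular R rs) (hmem : ∀ r ∈ rs, r ∈ p.asIdeal) :
    (rs.length : ℕ∞) ≤ Order.height p := by
  have hreg :=
    hrs.isRegular_of_isLocalization_of_mem (Localization.AtPrime p.asIdeal) p.asIdeal hmem
  have h := ringKrullDim_add_length_eq_ringKrullDim_of_isRegular _ hreg
  rw [List.length_map,
    IsLocalization.AtPrime.ringKrullDim_eq_height p.asIdeal (Localization.AtPrime p.asIdeal),
    PrimeSpectrum.height_eq_orderHeight] at h
  have hne : Nontrivial (Localization.AtPrime p.asIdeal ⧸ Ideal.ofList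
      (rs.map (algebraMap R (Localization.AtPrime p.asIdeal)))) := by
    refine Ideal.Quotient.nontrivial_iff.2 fun htop => hreg.2 ?_
    rw [htop, Submodule.top_smul]
  have h0 := ringKrullDim_nonneg_of_nontrivial (R := Localization.AtPrime p.asIdeal ⧸ Ideal.ofList
      (rs.map (algebraMap R (Localization.AtPrime p.asIdeal))))
  have h1 : ((rs.length : ℕ∞) : WithBot ℕ∞) ≤ (Order.height p : ℕ∞) := by
    rw [← h]
    exact le_add_of_nonneg_left h0
  exact WithBot.coe_le_coe.1 h1

/-- A prime `p` contains a regular sequence `rs` such that `p` is contained in an associated prime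
of `R/(rs)`. -/
lemma exists_isWeaklyRegular_le_associatedPrime (p : PrimeSpectrum R) :
    ∃ rs : List R, RingTheory.Sequence.IsWeaklyRegular R rs ∧ (∀ r ∈ rs, r ∈ p.asIdeal) ∧
      ∃ q : PrimeSpectrum R, p ≤ q ∧ IsAssociatedPrime q.asIdeal (R ⧸ Ideal.ofList rs) := by
  -- If `p` never lies in an associated prime of `R/(rs)`, prime avoidance extends every regular
  -- sequence in `p` by one element, against the bound by the height.
  by_contra hcon
  have hall : ∀ n : ℕ, ∃ rs : List R, rs.length = n ∧
      RingTheory.Sequence.IsWeaklyRegular R rs ∧ ∀ r ∈ rs, r ∈ p.asIdeal := by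
    intro n
    induction n with
    | zero => exact ⟨[], rfl, RingTheory.Sequence.IsWeaklyRegular.nil R R, by simp⟩
    | succ n ih =>
      obtain ⟨rs, hn, hrs, hmem⟩ := ih
      have hnot : ¬ (p.asIdeal : Set R) ⊆ ⋃ I ∈ associatedPrimes R (R ⧸ Ideal.ofList rs), I := by
        intro hsub
        obtain ⟨q, hq, hle⟩ := (Ideal.subset_union_prime_finite
          (associatedPrimes.finite R (R ⧸ Ideal.ofList rs)) ⊥ ⊥
          fun i hi _ _ => hi.isPrime).1 hsub
        exact hcon ⟨rs, hrs, hmem, ⟨q, hq.isPrime⟩, hle, hq⟩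
      rw [biUnion_associatedPrimes_eq_compl_regular] at hnot
      obtain ⟨x, hxp, hx⟩ := Set.not_subset.1 hnot
      refine ⟨rs ++ [x], by simp [hn], ?_, ?_⟩
      · refine (RingTheory.Sequence.isWeaklyRegular_append_iff _ _ _).2 ⟨hrs, ?_⟩
        rw [RingTheory.Sequence.isWeaklyRegular_singleton_iff, smul_eq_mul, Ideal.mul_top]
        exact not_not.1 hx
      · intro r hr
        rcases List.mem_append.1 hr with h | h
        · exact hmem r h
        · rwa [List.mem_singleton.1 h]
  have hfin : Order.height p ≠ ⊤ := by
    rw [← PrimeSpectrum.height_eq_orderHeight]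
    exact Ideal.height_ne_top p.2.ne_top
  obtain ⟨h, hh⟩ := ENat.ne_top_iff_exists.1 hfin
  obtain ⟨rs, hn, hrs, hmem⟩ := hall (h + 1)
  have := length_le_height_of_isWeaklyRegular p rs hrs hmem
  rw [hn, ← hh] at this
  exact absurd this (by norm_cast; lia)

variable [IsLocalRing R]

lemma subsingleton_ext_quotient_ofList {rs : List R} (hrs : RingTheory.Sequence.IsRegular R rs)
    (j : ℕ) (hj : rs.length < j) :
    Subsingleton (Ext (ModuleCat.of R (R ⧸ Ideal.ofList rs)) N j) := by
  have h := ModuleCat.projectiveDimension_quotient_eq_length.{u} rs hrs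
  rw [projectiveDimension_eq_of_iso (Y := ModuleCat.of R (R ⧸ Ideal.ofList rs))
    (Shrink.linearEquiv R (R ⧸ Ideal.ofList rs)).toModuleIso] at h
  have h' := (projectiveDimension_le_iff _ _).1 h.le
  exact HasProjectiveDimensionLT.subsingleton _ (rs.length + 1) j hj N

end Bass

/-! ### Grade and local injective dimension at a prime of a Gorenstein local ring -/

section Gorenstein

variable {R : Type u} [CommRing R] [IsGorensteinLocalRing R]

variable (R) in
lemma exists_subsingleton_ext : ∃ n : ℕ, ∀ (X : ModuleCat.{u} R) (j : ℕ), n ≤ j →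
    Subsingleton (Ext X (ModuleCat.of R R) j) := by
  obtain ⟨n, hn⟩ := (injectiveDimension_ne_top_iff (ModuleCat.of R R)).1
    (IsGorensteinLocalRing.injectiveDimension_lt_top (R := R)).ne
  exact ⟨n + 1, fun X j hj => HasInjectiveDimensionLT.subsingleton _ (n + 1) j hj X⟩

/-- The last nonvanishing Bass number of `R` at `q` occurs in a degree `≥ ht q`. -/
lemma exists_last_bass_number (q : PrimeSpectrum R) : ∃ e : ℕ, Order.height q ≤ e ∧
    ¬ ExtTorsion q.asIdeal.primeCompl (ModuleCat.of R (R ⧸ q.asIdeal)) (ModuleCat.of R R) e ∧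
    ∀ (X : ModuleCat.{u} R) [Module.Finite R X] (j : ℕ), e < j →
      ExtTorsion q.asIdeal.primeCompl X (ModuleCat.of R R) j := by
  classical
  obtain ⟨n, hn⟩ := exists_subsingleton_ext R
  obtain ⟨h, hh⟩ := ENat.ne_top_iff_exists.1 (show Order.height q ≠ ⊤ by
    rw [← PrimeSpectrum.height_eq_orderHeight]
    exact Ideal.height_ne_top q.2.ne_top)
  let P : ℕ → Prop := fun j =>
    ¬ ExtTorsion q.asIdeal.primeCompl (ModuleCat.of R (R ⧸ q.asIdeal)) (ModuleCat.of R R) j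
  have hP : ∀ j, P j → j ≤ n := fun j hj => by
    by_contra hlt
    exact hj (extTorsion_of_subsingleton (hn _ j (by lia)))
  have hPh : P h := not_extTorsion_height h q hh.symm
  refine ⟨Nat.findGreatest P n, ?_, Nat.findGreatest_spec (hP h hPh) hPh, fun X _ j hj => ?_⟩
  · rw [← hh]
    exact_mod_cast Nat.le_findGreatest (hP h hPh) hPh
  · refine extTorsion_of_lt q _ (fun i hi => ?_) X j hj
    by_contra hPi
    exact absurd (Nat.le_findGreatest (P := P) (hP i hPi) hPi) (by lia)

/-- In a Gorenstein local ring every prime `p` contains a regular sequence of length `ht p`, and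
`Ext^j(X, R)_p = 0` for all `j > ht p` and all finitely generated `X`. -/
lemma exists_isRegular_length_eq_height (p : PrimeSpectrum R) :
    ∃ rs : List R, RingTheory.Sequence.IsRegular R rs ∧ (∀ r ∈ rs, r ∈ p.asIdeal) ∧
      Order.height p = rs.length ∧
      ∀ (X : ModuleCat.{u} R) [Module.Finite R X] (j : ℕ), rs.length < j →
        ExtTorsion p.asIdeal.primeCompl X (ModuleCat.of R R) j := by
  obtain ⟨rs, hrs, hmem, q, hpq, hq⟩ := exists_isWeaklyRegular_le_associatedPrime p
  have hreg : RingTheory.Sequence.IsRegular R rs := by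
    refine ⟨hrs, fun htop => p.2.ne_top (eq_top_iff.2 ?_)⟩
    rw [smul_eq_mul, Ideal.mul_top] at htop
    rw [htop]
    exact Ideal.span_le.2 hmem
  obtain ⟨e, hqe, hne, he⟩ := exists_last_bass_number q
  -- `R/q` embeds in `R/(rs)`, whose projective dimension is `rs.length`. If `e` were larger,
  -- `Ext^e(R/(rs), R)` would vanish; `Ext^{e+1}` of the cokernel vanishes at `q` since `e` is the
  -- last degree. So `Ext^e(R/q, R)_q` would vanish too.
  have hle : e ≤ rs.length := by
    by_contra hlt
    obtain ⟨x, hx⟩ := hq.exists_smul_eq_zero_iff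
    let f := quotientToSpan q.asIdeal x fun r hr => (hx r).2 hr
    have hf : Function.Injective f := quotientToSpan_injective q.asIdeal x hx
    have hS := exactComplex_shortExact (LinearMap.exact_map_mkQ_range f) hf
      (Submodule.mkQ_surjective _)
    refine hne (ExtTorsion.left_of_succ hS ?_ ?_)
    · exact extTorsion_of_subsingleton (subsingleton_ext_quotient_ofList hreg e (by lia))
    · exact he (ModuleCat.of R ((R ⧸ Ideal.ofList rs) ⧸ LinearMap.range f)) (e + 1) (by lia)
  have hp := length_le_height_of_isWeaklyRegular p rs hrs hmem
  have hpq' := Order.height_mono hpq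
  -- The chain `ht q ≤ e ≤ rs.length ≤ ht p ≤ ht q` forces `p = q` and equality throughout.
  have hqp : Order.height q ≤ Order.height p :=
    hqe.trans ((by exact_mod_cast hle : (e : ℕ∞) ≤ rs.length).trans hp)
  have hfin : Order.height p < ⊤ := (hpq'.trans hqe).trans_lt (ENat.natCast_lt_top e)
  obtain rfl : p = q := by
    by_contra hne
    exact absurd (Order.height_strictMono (lt_of_le_of_ne hpq hne) hfin) hqp.not_gt
  have heq : Order.height p = rs.length :=
    le_antisymm (hqe.trans (by exact_mod_cast hle)) hp
  refine ⟨rs, hreg, hmem, heq, fun X _ j hj => he X j (by lia)⟩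

/-- This and `subsingleton_ext_of_lt_height` are what the Cousin complex of the ring takes from the
Gorenstein hypothesis: the upper bound makes its terms injective, the lower bound makes it exact. -/
lemma extTorsion_of_height_lt (p : PrimeSpectrum R) (X : ModuleCat.{u} R) [Module.Finite R X]
    (j : ℕ) (hj : Order.height p < j) : ExtTorsion p.asIdeal.primeCompl X (ModuleCat.of R R) j := by
  obtain ⟨rs, -, -, h, hX⟩ := exists_isRegular_length_eq_height p
  rw [h] at hj
  exact hX X j (by exact_mod_cast hj)

lemma subsingleton_ext_of_lt_height (p : PrimeSpectrum R) (i : ℕ) (hi : i < Order.height p) :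
    Subsingleton (Ext (ModuleCat.of R (R ⧸ p.asIdeal)) (ModuleCat.of R R) i) := by
  obtain ⟨rs, hreg, hmem, h, -⟩ := exists_isRegular_length_eq_height p
  rw [h] at hi
  refine ModuleCat.subsingleton_ext_of_exists_isRegular p.asIdeal
    (ModuleCat.of R (R ⧸ p.asIdeal)) ?_ (ModuleCat.of R R) ?_ rs hmem hreg i (by exact_mod_cast hi)
  · exact (Module.support_eq_zeroLocus.trans (by rw [Ideal.annihilator_quotient])).subset
  · rw [smul_eq_mul, Ideal.mul_top]
    exact p.2.ne_top.lt_top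

end Gorenstein

/-! ### The Cousin complex of a Gorenstein local ring -/

section ExtVanishing

variable {R : Type u} [CommRing R]

lemma subsingleton_ext_of_injective {X N : ModuleCat.{u} R} (h : Module.Injective R N) (j : ℕ) :
    Subsingleton (Ext X N (j + 1)) := by
  have := (Module.injective_iff_injective_object R N).1 h
  exact HasInjectiveDimensionLT.subsingleton N 1 (j + 1) (by lia) X

lemma subsingleton_ext_zero_iff {X N : ModuleCat.{u} R} :
    Subsingleton (Ext X N 0) ↔ Subsingleton (X →ₗ[R] N) :=
  (Ext.addEquiv₀.trans ModuleCat.homAddEquiv).toEquiv.subsingleton_congr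

end ExtVanishing

section LocSum

variable {R : Type u} [CommRing R]

lemma LocSum.ext {A : Set (PrimeSpectrum R)} {C : Type u} [AddCommGroup C] [Module R C]
    {x y : LocSum A C} (h : ∀ p, x p = y p) : x = y :=
  DFinsupp.ext h

lemma LocSum.smul_apply {A : Set (PrimeSpectrum R)} {C : Type u} [AddCommGroup C] [Module R C]
    (r : R) (x : LocSum A C) (p : A) : (r • x) p = r • x p :=
  rfl

lemma LocalizedModule.eq_of_smul_eq_smul {S : Submonoid R} {C : Type*} [AddCommGroup C] [Module R C]
    {s : R} (hs : s ∈ S) {x y : LocalizedModule S C} (h : s • x = s • y) : x = y :=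
  IsLocalizedModule.smul_injective (LocalizedModule.mkLinearMap S C) (⟨s, hs⟩ : S) h

lemma LocalizedModule.exists_smul_eq {S : Submonoid R} {C : Type*} [AddCommGroup C] [Module R C]
    {s : R} (hs : s ∈ S) (y : LocalizedModule S C) : ∃ x, s • x = y := by
  induction y using LocalizedModule.induction_on with
  | _ c t =>
  refine ⟨LocalizedModule.mk c (⟨s, hs⟩ * t), ?_⟩
  rw [LocalizedModule.smul'_mk, LocalizedModule.mk_eq]
  refine ⟨1, ?_⟩
  simp only [one_smul, Submonoid.smul_def, Submonoid.coe_mul, smul_smul]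
  rw [mul_comm]

/-- If `Ext^1(R/I, C)` is `S`-torsion then each map `I → C` extends to `R` up to multiplication by
an element of `S`. -/
lemma exists_extension_of_extTorsion {S : Submonoid R} {C : Type u} [AddCommGroup C] [Module R C]
    (I : Ideal R) (h : ExtTorsion S (ModuleCat.of R (R ⧸ I)) (ModuleCat.of R C) 1)
    (g : I →ₗ[R] C) : ∃ s ∈ S, ∃ c : C, ∀ r : I, s • g r = (r : R) • c := by
  have hex : Function.Exact I.subtype I.mkQ := LinearMap.exact_subtype_mkQ I
  have hT := exactComplex_shortExact hex I.injective_subtype I.mkQ_surjective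
  -- This class in `Ext^1(R/I, C)` is the obstruction to extending `g` to `R`; once `s` kills it, `s
  -- • g` extends.
  obtain ⟨s, hs, h0⟩ := h (hT.extClass.comp (Ext.mk₀ (ModuleCat.ofHom g)) (add_zero 1))
  rw [← Ext.comp_smul] at h0
  obtain ⟨e, he⟩ := Ext.contravariant_sequence_exact₁ hT _ _ _ h0
  obtain ⟨f, rfl⟩ := (Ext.mk₀_bijective _ _).2 e
  rw [Ext.mk₀_comp_mk₀, ← Ext.mk₀_smul] at he
  have he' := (Ext.mk₀_bijective _ _).1 he
  refine ⟨s, hs, f.hom (1 : R), fun r => ?_⟩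
  have h1 : f.hom (r : R) = s • g r := congrArg (fun f => f.hom r) he'
  rw [← h1, ← map_smul, smul_eq_mul, mul_one]

variable (F : SpecFiltration R) (hF : ∀ i p, p ∈ F.carrier i ↔ (i : ℕ∞) ≤ Order.height p)

include hF

lemma mem_bd_iff (i : ℕ) (p : PrimeSpectrum R) : p ∈ F.bd i ↔ Order.height p = i := by
  rw [SpecFiltration.bd, Set.mem_sdiff, hF, hF, not_le, Nat.cast_add, Nat.cast_one,
    ENat.lt_add_one_iff (ENat.natCast_ne_top i)]
  exact ⟨fun h => le_antisymm h.2 h.1, fun h => ⟨h.ge, h.le⟩⟩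

/-- A prime of height greater than `i` is not contained in a prime `p` of height `i`. An element of
`q` outside `p` is zero on `R/q` but acts injectively on `C_p`. -/
lemma subsingleton_hom_locSum (i : ℕ) (C : Type u) [AddCommGroup C] [Module R C]
    (q : PrimeSpectrum R) (hq : (i : ℕ∞) < Order.height q) :
    Subsingleton ((R ⧸ q.asIdeal) →ₗ[R] LocSum (F.bd i) C) := by
  refine subsingleton_of_forall_eq 0 fun f => LinearMap.ext fun y => LocSum.ext fun p => ?_
  have hp := (mem_bd_iff F hF i p.1).1 p.2
  have hqp : ¬ q ≤ p.1 := fun hle => by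
    have := Order.height_mono hle
    rw [hp] at this
    exact this.not_gt hq
  obtain ⟨r, hrq, hrp⟩ := Set.not_subset.1 hqp
  refine LocalizedModule.eq_of_smul_eq_smul (S := p.1.asIdeal.primeCompl) (s := r) hrp ?_
  have hy : r • y = 0 := by
    have : r ∈ Module.annihilator R (R ⧸ q.asIdeal) := by rwa [Ideal.annihilator_quotient]
    exact Module.mem_annihilator.1 this y
  rw [← LocSum.smul_apply, ← map_smul, hy, map_zero, LinearMap.zero_apply]
  exact (smul_zero r).symm

omit hF

variable [IsNoetherianRing R]

/-- If `Ext^1(R/I, C)_p = 0` for all ideals `I` and all `p ∈ A`, then `⨁_{p ∈ A} C_p` is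
injective. -/
lemma injective_locSum (A : Set (PrimeSpectrum R)) (C : Type u) [AddCommGroup C] [Module R C]
    (h : ∀ p ∈ A, ∀ I : Ideal R,
      ExtTorsion p.asIdeal.primeCompl (ModuleCat.of R (R ⧸ I)) (ModuleCat.of R C) 1) :
    Module.Injective R (LocSum A C) := by
  classical
  refine Module.Baer.injective fun I g => ?_
  -- Baer's criterion one component at a time: up to a factor `s` the component of `g` comes from a
  -- map `I → C`, which up to a factor `t` extends to `R`; both factors can be divided out in `C_p`.
  have hloc : ∀ p : A, ∃ y : LocalizedModule p.1.asIdeal.primeCompl C,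
      ∀ r : I, g r p = (r : R) • y := by
    intro p
    have := Module.finitePresentation_of_finite R I
    obtain ⟨g', s, hg'⟩ := Module.FinitePresentation.exists_lift_of_isLocalizedModule
      p.1.asIdeal.primeCompl (LocalizedModule.mkLinearMap p.1.asIdeal.primeCompl C)
      (DirectSum.component R A _ p ∘ₗ g)
    obtain ⟨t, ht, c, hc⟩ := exists_extension_of_extTorsion I (h p.1 p.2 I) g'
    have hts := p.1.asIdeal.primeCompl.mul_mem ht s.2
    obtain ⟨y, hy⟩ := LocalizedModule.exists_smul_eq hts
      (LocalizedModule.mkLinearMap p.1.asIdeal.primeCompl C c)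
    refine ⟨y, fun r => LocalizedModule.eq_of_smul_eq_smul hts ?_⟩
    rw [smul_comm _ (r : R), hy, ← map_smul, ← hc, map_smul, mul_smul]
    have := LinearMap.congr_fun hg' r
    rw [LinearMap.comp_apply] at this
    rw [this]
    rfl
  choose y hy using hloc
  obtain ⟨G, hG⟩ := (isNoetherianRing_iff_ideal_fg R).1 inferInstance I
  have hGI : ∀ r ∈ G, r ∈ I := fun r hr => hG ▸ Ideal.subset_span hr
  let s : Finset A := G.attach.biUnion fun r => DFinsupp.support (g ⟨r.1, hGI r.1 r.2⟩)
  -- Finite generation of `I` leaves only finitely many nonzero components of `g`, so the chosen `y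
  -- p` can be assembled in the direct sum.
  have hs : ∀ p ∉ s, ∀ r : I, g r p = 0 := by
    intro p hp
    have hker : I ≤ (LinearMap.ker (DirectSum.component R A _ p ∘ₗ g)).map I.subtype := by
      conv_lhs => rw [← hG]
      refine Ideal.span_le.2 fun r hr => ⟨⟨r, hGI r hr⟩, ?_, rfl⟩
      by_contra hne
      exact hp (Finset.mem_biUnion.2 ⟨⟨r, hr⟩, Finset.mem_attach _ _,
        DFinsupp.mem_support_iff.2 hne⟩)
    rintro ⟨r, hr⟩
    obtain ⟨r', hr', rfl⟩ := hker hr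
    exact hr'
  let z : LocSum A C := DirectSum.mk _ s fun p => y p.1
  refine ⟨LinearMap.toSpanSingleton R _ z, fun r hr => LocSum.ext fun p => ?_⟩
  rw [LinearMap.toSpanSingleton_apply, LocSum.smul_apply]
  by_cases hp : p ∈ s
  · rw [show z p = y p from DirectSum.mk_apply_of_mem hp]
    exact (hy p ⟨r, hr⟩).symm
  · rw [show z p = 0 from DirectSum.mk_apply_of_notMem hp, smul_zero]
    exact (hs p hp ⟨r, hr⟩).symm

-- An associated prime `q` of the kernel is the annihilator of some `x` and lies in `Fᵢ`. If `ht q =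
-- i`, then `x` survives in the component `C_q`; if `ht q > i`, then `R/q` would embed in `C`,
-- against `h`.
include hF in
lemma toLocSum_injective (i : ℕ) (C : Type u) [AddCommGroup C] [Module R C]
    (hC : Module.support R C ⊆ F.carrier i)
    (h : ∀ q : PrimeSpectrum R, (i : ℕ∞) < Order.height q →
      Subsingleton ((R ⧸ q.asIdeal) →ₗ[R] C)) :
    Function.Injective (toLocSum F i C hC) := by
  rw [← LinearMap.ker_eq_bot]
  by_contra hne
  have : Nontrivial (LinearMap.ker (toLocSum F i C hC)) :=
    Submodule.nontrivial_iff_ne_bot.2 hne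
  obtain ⟨q, hq⟩ := associatedPrimes.nonempty R (LinearMap.ker (toLocSum F i C hC))
  obtain ⟨⟨x, hx⟩, hxq⟩ := hq.exists_smul_eq_zero_iff
  have hxq' : ∀ r : R, r • x = 0 ↔ r ∈ q := fun r => by
    rw [← hxq, ← Subtype.coe_inj]
    rfl
  have hqF : (⟨q, hq.isPrime⟩ : PrimeSpectrum R) ∈ F.carrier i :=
    hC (mem_support_of_annihilates ⟨q, hq.isPrime⟩ x fun r hr => (hxq' r).1 hr)
  rcases ((hF i _).1 hqF).eq_or_lt with heq | hlt
  · have h0 := toLocSum_apply F i C hC x ⟨⟨q, hq.isPrime⟩, (mem_bd_iff F hF i _).2 heq.symm⟩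
    rw [LinearMap.mem_ker.1 hx] at h0
    refine (localized_ne_zero_iff (⟨q, hq.isPrime⟩ : PrimeSpectrum R) x).2
      (fun r hr => (hxq' r).1 hr) ?_
    exact h0.symm
  · have := h _ hlt
    have h1 : quotientToSpan q x (fun r hr => (hxq' r).2 hr) = 0 := Subsingleton.elim _ _
    have h2 := LinearMap.congr_fun h1 (Ideal.Quotient.mk q 1)
    rw [quotientToSpan_mk, one_smul] at h2
    refine hq.isPrime.ne_top ((Ideal.eq_top_iff_one q).2 ((hxq' 1).1 ?_))
    rw [one_smul, h2]
    rfl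

end LocSum

section Cousin

variable {R : Type u} [CommRing R] [IsNoetherianRing R] (F : SpecFiltration R) (M : Type u)
  [AddCommGroup M] [Module R M] (hM : Module.support R M ⊆ F.carrier 0)

lemma exact_cousinCokerToTerm_cousinProj (i : ℕ) :
    Function.Exact (cousinCokerToTerm F M hM i) (cousinProj F M hM i) :=
  LinearMap.exact_map_mkQ_range _

/-- The Cousin complex is spliced from the right exact sequences `coker d^{i-2} → M^i → coker
d^{i-1} → 0`; its exactness means that each of them is also exact on the left. -/
lemma cousinExact_iff : CousinExact F M hM ↔
    ∀ i, Function.Injective (cousinCokerToTerm F M hM i) := by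
  have hcomp : ∀ i, LinearMap.ker (cousinD F M hM i) =
      (LinearMap.ker (cousinCokerToTerm F M hM (i + 1))).comap (cousinProj F M hM i) := fun i =>
    LinearMap.ker_comp _ _
  have hstep : ∀ i, Function.Injective (cousinCokerToTerm F M hM (i + 1)) ↔
      LinearMap.ker (cousinD F M hM i) = LinearMap.ker (cousinProj F M hM i) := by
    intro i
    rw [hcomp, ← LinearMap.ker_eq_bot]
    refine ⟨fun h => by rw [h]; rfl, fun h => ?_⟩
    apply Submodule.comap_injective_of_surjective (cousinProj_surjective F M hM i)
    rw [h]
    rfl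
  have h0 : Function.Exact (cousinAug F M hM) (cousinD F M hM 0) ↔
      Function.Injective (cousinCokerToTerm F M hM 1) := by
    rw [hstep 0, ker_cousinProj_zero, LinearMap.exact_iff]
  have hs : ∀ i, Function.Exact (cousinD F M hM i) (cousinD F M hM (i + 1)) ↔
      Function.Injective (cousinCokerToTerm F M hM (i + 1 + 1)) := by
    intro i
    rw [hstep (i + 1), ker_cousinProj_succ, LinearMap.exact_iff]
  refine ⟨fun ⟨h, h', h''⟩ i => ?_, fun h => ⟨h 0, h0.2 (h 1), fun i => (hs i).2 (h _)⟩⟩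
  match i with
  | 0 => exact h
  | 1 => exact h0.1 h'
  | i + 2 => exact (hs i).1 (h'' i)

variable {F M hM}

lemma cousin_shortExact {i : ℕ} (h : Function.Injective (cousinCokerToTerm F M hM i)) :
    (exactComplex _ _ (exact_cousinCokerToTerm_cousinProj F M hM i)).ShortExact :=
  exactComplex_shortExact _ h (cousinProj_surjective F M hM i)

lemma subsingleton_cousinCoker {i : ℕ} (hi : F.carrier i = ∅) :
    Subsingleton (cousinCoker F M hM i) := by
  rw [← Module.support_eq_empty_iff (R := R), ← Set.subset_empty_iff, ← hi]
  exact support_cousinCoker_subset F M hM i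

/-- If the Cousin complex of `M` is exact with injective terms and ends, `M` has finite injective
dimension. -/
lemma hasInjectiveDimensionLT_of_cousin {n : ℕ} (hn : F.carrier n = ∅)
    (h : ∀ i, Function.Injective (cousinCokerToTerm F M hM i))
    (hinj : ∀ i, Module.Injective R (cousinTerm F M hM i)) :
    HasInjectiveDimensionLT (ModuleCat.of R M) n := by
  suffices ∀ k i, i + k = n → HasInjectiveDimensionLT (cousinCoker F M hM i) k from
    this n 0 (by lia)
  intro k
  induction k with
  | zero =>
    rintro i rfl
    have := subsingleton_cousinCoker (F := F) (hM := hM) hn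
    exact (ModuleCat.isZero_of_subsingleton _).hasInjectiveDimensionLT_zero
  | succ k ih =>
    intro i hi
    have h1 := ih (i + 1) (by lia)
    have h2 := (Module.injective_iff_injective_object R _).1 (hinj i)
    exact (cousin_shortExact (h i)).hasInjectiveDimensionLT_X₁ k h1
      (hasInjectiveDimensionLT_of_ge (cousinTerm F M hM i) 1 (k + 1) (by lia))

end Cousin

section CousinGorenstein

variable {R : Type u} [CommRing R] [IsGorensteinLocalRing R] {F : SpecFiltration R}
  (hF : ∀ i p, p ∈ F.carrier i ↔ (i : ℕ∞) ≤ Order.height p)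
  (hM : Module.support R R ⊆ F.carrier 0)

include hF

/-- The cosyzygies in the Cousin complex of a Gorenstein local ring compute the `Ext` modules of
the ring. -/
lemma cousinCoker_ext (i : ℕ) :
    (∀ (S : Submonoid R) (X : ModuleCat.{u} R) (j : ℕ),
      ExtTorsion S X (ModuleCat.of R R) (j + 1 + i) →
      ExtTorsion S X (cousinCoker F R hM i) (j + 1)) ∧
    (∀ q : PrimeSpectrum R, (i : ℕ∞) < Order.height q →
      Subsingleton ((R ⧸ q.asIdeal) →ₗ[R] cousinCoker F R hM i)) ∧
    Function.Injective (cousinCokerToTerm F R hM i) ∧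
    Module.Injective R (cousinTerm F R hM i) := by
  -- The two statements on `Ext` and `Hom` in degree `i` yield the other two: at `ht p = i`,
  -- `Ext^1(R/I, coker d^{i-2})_p` is controlled by `Ext^{i+1}(R/I, R)_p`, which vanishes.
  have key : ∀ i, (∀ (S : Submonoid R) (X : ModuleCat.{u} R) (j : ℕ),
      ExtTorsion S X (ModuleCat.of R R) (j + 1 + i) →
        ExtTorsion S X (cousinCoker F R hM i) (j + 1)) →
      (∀ q : PrimeSpectrum R, (i : ℕ∞) < Order.height q →
        Subsingleton ((R ⧸ q.asIdeal) →ₗ[R] cousinCoker F R hM i)) →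
      Function.Injective (cousinCokerToTerm F R hM i) ∧
        Module.Injective R (cousinTerm F R hM i) := by
    intro i h₁ h₂
    refine ⟨toLocSum_injective F hF i _ _ h₂, injective_locSum _ _ fun p hp I => ?_⟩
    refine h₁ _ _ 0 (extTorsion_of_height_lt p _ _ ?_)
    rw [(mem_bd_iff F hF i p).1 hp]
    norm_cast
    lia
  suffices h : (∀ (S : Submonoid R) (X : ModuleCat.{u} R) (j : ℕ),
      ExtTorsion S X (ModuleCat.of R R) (j + 1 + i) →
        ExtTorsion S X (cousinCoker F R hM i) (j + 1)) ∧
      (∀ q : PrimeSpectrum R, (i : ℕ∞) < Order.height q →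
        Subsingleton ((R ⧸ q.asIdeal) →ₗ[R] cousinCoker F R hM i)) from
    ⟨h.1, h.2, key i h.1 h.2⟩
  induction i with
  | zero =>
    refine ⟨fun S X j h => h, fun q hq => ?_⟩
    exact subsingleton_ext_zero_iff.1 (subsingleton_ext_of_lt_height q 0 (by exact_mod_cast hq))
  | succ i ih =>
    obtain ⟨hmono, hinj⟩ := key i ih.1 ih.2
    have hS := cousin_shortExact hmono
    refine ⟨fun S X j h => ?_, fun q hq => ?_⟩
    · refine ExtTorsion.right_of_succ hS (ih.1 S X (j + 1) ?_) ?_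
      · rwa [show j + 1 + 1 + i = j + 1 + (i + 1) by ring]
      · exact extTorsion_of_subsingleton (subsingleton_ext_of_injective hinj j)
    -- `Hom(R/q, -)` of the next cosyzygy lies between `Hom(R/q, M^i)`, zero because `ht q > i`, and
    -- `Ext^1` into the present cosyzygy, zero because `Ext^{i+1}(R/q, R) = 0` for `i + 1 < ht q`.
    · rw [← subsingleton_ext_zero_iff (X := ModuleCat.of R (R ⧸ q.asIdeal)), ← extTorsion_bot_iff]
      refine ExtTorsion.right_of_succ hS (ih.1 _ _ 0 ?_) ?_
      · rw [extTorsion_bot_iff]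
        exact subsingleton_ext_of_lt_height q _ (by rwa [show 0 + 1 + i = i + 1 by ring])
      · rw [extTorsion_bot_iff, subsingleton_ext_zero_iff]
        refine subsingleton_hom_locSum F hF i _ q (lt_of_le_of_lt ?_ hq)
        exact_mod_cast Nat.le_succ i

end CousinGorenstein

/-! ### The Cousin complex and tensor products -/

section CousinTensor

variable {R : Type u} [CommRing R]

/-- Localization and direct sums commute with `- ⊗ M`. The condition on `ψ`, read one component at a
time, is compatibility with the canonical map from `C` whenever that map exists. -/
lemma exists_locSum_tensor (A : Set (PrimeSpectrum R)) {C C' M : Type u} [AddCommGroup C]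
    [Module R C] [AddCommGroup C'] [Module R C'] [AddCommGroup M] [Module R M]
    (e : C ⊗[R] M ≃ₗ[R] C') :
    ∃ ψ : LocSum A C ⊗[R] M ≃ₗ[R] LocSum A C', ∀ (z : LocSum A C) (c : C) (m : M) (p : A),
      z p = LocalizedModule.mk c 1 → ψ (z ⊗ₜ m) p = LocalizedModule.mk (e (c ⊗ₜ m)) 1 := by
  classical
  have hinst : ∀ p : A, IsLocalizedModule p.1.asIdeal.primeCompl
      (LinearMap.rTensor M (LocalizedModule.mkLinearMap p.1.asIdeal.primeCompl C)) := fun p =>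
    IsLocalizedModule.rTensor R p.1.asIdeal.primeCompl _
  let ε : ∀ p : A, LocalizedModule p.1.asIdeal.primeCompl C ⊗[R] M ≃ₗ[R]
      LocalizedModule p.1.asIdeal.primeCompl C' := fun p =>
    IsLocalizedModule.linearEquiv p.1.asIdeal.primeCompl
      (LinearMap.rTensor M (LocalizedModule.mkLinearMap p.1.asIdeal.primeCompl C))
      (LocalizedModule.mkLinearMap p.1.asIdeal.primeCompl C' ∘ₗ e.toLinearMap)
  have hε : ∀ (p : A) (c : C) (m : M), ε p (LocalizedModule.mk c 1 ⊗ₜ m) =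
      LocalizedModule.mk (e (c ⊗ₜ m)) 1 := fun p c m =>
    IsLocalizedModule.linearEquiv_apply p.1.asIdeal.primeCompl
      (LinearMap.rTensor M (LocalizedModule.mkLinearMap p.1.asIdeal.primeCompl C))
      (LocalizedModule.mkLinearMap p.1.asIdeal.primeCompl C' ∘ₗ e.toLinearMap) (c ⊗ₜ m)
  refine ⟨(TensorProduct.directSumLeft R R _ M).trans (DFinsupp.mapRange.linearEquiv ε),
    fun z c m p hz => ?_⟩
  rw [LinearEquiv.trans_apply]
  refine (DFinsupp.mapRange_apply (fun p => ε p) (fun p => map_zero (ε p)) _ p).trans ?_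
  rw [← hε, ← hz, TensorProduct.directSumLeft_tmul]

variable [IsNoetherianRing R] {F : SpecFiltration R} {M : Type u} [AddCommGroup M] [Module R M]

/-- The Cousin complex of `M` is the tensor product of `M` with that of `R`. -/
lemma exists_cousin_tensor (hR : Module.support R R ⊆ F.carrier 0)
    (hM : Module.support R M ⊆ F.carrier 0) (i : ℕ) :
    ∃ (φ : cousinCoker F R hR i ⊗[R] M ≃ₗ[R] cousinCoker F M hM i)
      (ψ : cousinTerm F R hR i ⊗[R] M ≃ₗ[R] cousinTerm F M hM i),
      ∀ x, ψ (LinearMap.rTensor M (cousinCokerToTerm F R hR i) x) =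
        cousinCokerToTerm F M hM i (φ x) := by
  have key : ∀ (i : ℕ) (φ : cousinCoker F R hR i ⊗[R] M ≃ₗ[R] cousinCoker F M hM i),
      ∃ ψ : cousinTerm F R hR i ⊗[R] M ≃ₗ[R] cousinTerm F M hM i,
      ∀ x, ψ (LinearMap.rTensor M (cousinCokerToTerm F R hR i) x) =
        cousinCokerToTerm F M hM i (φ x) := by
    intro i φ
    obtain ⟨ψ, hψ⟩ := exists_locSum_tensor (F.bd i) φ
    let ψ' : cousinTerm F R hR i ⊗[R] M ≃ₗ[R] cousinTerm F M hM i := ψ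
    refine ⟨ψ', LinearMap.congr_fun (TensorProduct.ext'
      (g := ψ'.toLinearMap ∘ₗ LinearMap.rTensor M (cousinCokerToTerm F R hR i))
      (h := cousinCokerToTerm F M hM i ∘ₗ φ.toLinearMap) fun c m => LocSum.ext fun p => ?_)⟩
    refine (hψ _ c m p (toLocSum_apply F i _ (support_cousinCoker_subset F R hR i) c p)).trans ?_
    exact (toLocSum_apply F i _ (support_cousinCoker_subset F M hM i) _ p).symm
  suffices h : Nonempty (cousinCoker F R hR i ⊗[R] M ≃ₗ[R] cousinCoker F M hM i) by
    obtain ⟨φ⟩ := h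
    exact ⟨φ, key i φ⟩
  induction i with
  | zero => exact ⟨TensorProduct.lid R M⟩
  | succ i ih =>
    obtain ⟨φ⟩ := ih
    obtain ⟨ψ, hψ⟩ := key i φ
    -- By right exactness the next cokernel tensored with `M` is the quotient of the tensored term,
    -- and `ψ` carries the submodule divided out to the one for `M`.
    refine ⟨(rTensor.equiv M (exact_cousinCokerToTerm_cousinProj F R hR i)
      (cousinProj_surjective F R hR i)).symm.trans (Submodule.Quotient.equiv _ _ ψ ?_)⟩
    ext y
    constructor
    · rintro ⟨_, ⟨x, rfl⟩, rfl⟩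
      exact ⟨φ x, (hψ x).symm⟩
    · rintro ⟨x, rfl⟩
      exact ⟨_, ⟨φ.symm x, rfl⟩, (hψ _).trans
        (congrArg (cousinCokerToTerm F M hM i) (φ.apply_symm_apply x))⟩

end CousinTensor

/-! ### Complexes of matrices acting on a module -/

section MatrixAction

variable {R : Type u} [CommRing R]

/-- The map `N^b → N^a` given by an `a × b` matrix over `R`. -/
def Matrix.act {a b : ℕ} (A : Matrix (Fin a) (Fin b) R) (N : Type*) [AddCommGroup N]
    [Module R N] : (Fin b → N) →ₗ[R] (Fin a → N) :=
  LinearMap.pi fun i => ∑ j, A i j • LinearMap.proj j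

variable {a b c d : ℕ} (A : Matrix (Fin a) (Fin b) R) (B : Matrix (Fin b) (Fin c) R)
  {N N' N'' : Type*} [AddCommGroup N] [Module R N] [AddCommGroup N'] [Module R N']
  [AddCommGroup N''] [Module R N'']

lemma Matrix.act_apply (v : Fin b → N) (i : Fin a) : A.act N v i = ∑ j, A i j • v j := by
  simp [Matrix.act]

lemma Matrix.act_comp (f : N →ₗ[R] N') (v : Fin b → N) :
    A.act N' (fun j => f (v j)) = fun i => f (A.act N v i) := by
  ext i
  simp [Matrix.act_apply]

lemma Matrix.act_single [DecidableEq (Fin b)] (j : Fin b) (x : N) :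
    A.act N (Pi.single j x) = fun i => A i j • x := by
  ext i
  rw [Matrix.act_apply,
    Finset.sum_eq_single j (fun k _ hk => by rw [Pi.single_eq_of_ne hk, smul_zero])
    (by simp), Pi.single_eq_same]

/-- A linear map into an injective module which vanishes on `ker f` factors through `f`. -/
lemma exists_factor_of_injective {X Y Z : Type u} [AddCommGroup X] [Module R X] [AddCommGroup Y]
    [Module R Y] [AddCommGroup Z] [Module R Z] (hZ : Module.Injective R Z) (f : X →ₗ[R] Y)
    (g : X →ₗ[R] Z) (h : LinearMap.ker f ≤ LinearMap.ker g) : ∃ k : Y →ₗ[R] Z, k ∘ₗ f = g := by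
  obtain ⟨k, hk⟩ := hZ.out ((LinearMap.ker f).liftQ f le_rfl)
    (LinearMap.ker_eq_bot.1 (Submodule.ker_liftQ_eq_bot _ _ _ le_rfl))
    ((LinearMap.ker f).liftQ g h)
  exact ⟨k, LinearMap.ext fun x => hk ((LinearMap.ker f).mkQ x)⟩

variable {A B} {C : Matrix (Fin c) (Fin d) R}

/-- Exactness of a sequence of matrices passes to the transposes under `Hom(-, N)` with `N`
injective. -/
lemma Matrix.exact_act_hom {I N : Type u} [AddCommGroup I] [Module R I] [AddCommGroup N]
    [Module R N] (hN : Module.Injective R N) (h : Function.Exact (B.act I) (A.act I)) :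
    Function.Exact (A.transpose.act (I →ₗ[R] N)) (B.transpose.act (I →ₗ[R] N)) := by
  have hsum : ∀ (n : ℕ) (w : Fin n → (I →ₗ[R] N)) (v : Fin n → I),
      LinearMap.lsum R (fun _ => I) R w v = ∑ j, w j (v j) := fun n w v => by
    simp [LinearMap.lsum_apply]
  -- A tuple of maps `I → N` is a map from a power of `I` to `N`; under this pairing a matrix and
  -- its transpose are adjoint.
  have hadj : ∀ (m n : ℕ) (M : Matrix (Fin m) (Fin n) R) (w : Fin m → (I →ₗ[R] N)) (v : Fin n → I),
      ∑ j, (M.transpose.act (I →ₗ[R] N) w) j (v j) = ∑ i, w i (M.act I v i) := by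
    intro m n M w v
    simp only [Matrix.act_apply, Matrix.transpose_apply, LinearMap.sum_apply, LinearMap.smul_apply,
      map_sum, map_smul]
    exact Finset.sum_comm
  intro w
  constructor
  · intro hw
    -- The map given by `w` vanishes on the range of `B`, which is the kernel of `A`. It thus
    -- factors through `A`, and the components of the factor form the preimage of `w`.
    obtain ⟨k, hk⟩ := exists_factor_of_injective hN (A.act I)
      (LinearMap.lsum R (fun _ => I) R w) (by
      intro v hv
      obtain ⟨u, rfl⟩ := (h v).1 hv
      rw [LinearMap.mem_ker, hsum, ← hadj, hw]
      simp)
    refine ⟨fun i => k ∘ₗ LinearMap.single R (fun _ => I) i,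
      funext fun j => LinearMap.ext fun x => ?_⟩
    have h1 := LinearMap.congr_fun hk (Pi.single j x)
    rw [hsum, LinearMap.comp_apply, Matrix.act_single] at h1
    rw [Finset.sum_eq_single j (fun k _ hk => by rw [Pi.single_eq_of_ne hk, map_zero]) (by simp),
      Pi.single_eq_same] at h1
    rw [← h1, Matrix.act_apply, LinearMap.sum_apply]
    have h2 : (fun i => A i j • x) = ∑ i, Pi.single i (A i j • x) := by
      rw [Finset.univ_sum_single]
    rw [h2, map_sum]
    refine Finset.sum_congr rfl fun i _ => ?_
    rw [LinearMap.smul_apply, LinearMap.comp_apply, ← map_smul, ← map_smul]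
    rfl
  · rintro ⟨u, rfl⟩
    funext j
    refine LinearMap.ext fun x => ?_
    have h1 := hadj _ _ B (A.transpose.act _ u) (Pi.single j x)
    have h2 := hadj _ _ A u (B.act I (Pi.single j x))
    rw [(h _).2 ⟨_, rfl⟩] at h2
    rw [h2, Finset.sum_eq_single j (fun k _ hk => by
      rw [Pi.single_eq_of_ne hk, map_zero]) (by simp), Pi.single_eq_same] at h1
    rw [h1]
    simp

lemma Matrix.exact_act_of_linearEquiv (e : N ≃ₗ[R] N') (h : Function.Exact (B.act N) (A.act N)) :
    Function.Exact (B.act N') (A.act N') := by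
  have hc : ∀ {m n : ℕ} (M : Matrix (Fin m) (Fin n) R) (v : Fin n → N'),
      M.act N' v = fun i => e (M.act N (fun j => e.symm (v j)) i) := by
    intro m n M v
    refine Eq.trans ?_ (Matrix.act_comp M e.toLinearMap fun j => e.symm (v j))
    simp
  intro v
  have h1 := h (fun j => e.symm (v j))
  constructor
  · intro hv
    rw [hc] at hv
    obtain ⟨u, hu⟩ := h1.1 (funext fun i => e.injective ((congrFun hv i).trans (map_zero e).symm))
    refine ⟨fun j => e (u j), funext fun i => ?_⟩
    rw [hc]
    simp [hu]
  · rintro ⟨u, rfl⟩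
    rw [hc, hc]
    funext i
    simp only [LinearEquiv.symm_apply_apply]
    rw [(h _).2 ⟨_, rfl⟩]
    simp

/-- Exactness of a sequence of matrices over `R` passes to the transposes acting on an injective
module. -/
lemma Matrix.exact_act_injective {N : Type u} [AddCommGroup N] [Module R N]
    (hN : Module.Injective R N) (h : Function.Exact (B.act R) (A.act R)) :
    Function.Exact (A.transpose.act N) (B.transpose.act N) :=
  Matrix.exact_act_of_linearEquiv (LinearMap.ringLmapEquivSelf R R N) (Matrix.exact_act_hom hN h)

/-- In a short exact sequence `0 → N → N' → N'' → 0`, exactness of a complex of matrices on `N'` and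
`N''` implies exactness on `N`. -/
lemma Matrix.exact_act_of_shortExact {f : N →ₗ[R] N'} {g : N' →ₗ[R] N''}
    (hf : Function.Injective f) (hg : Function.Surjective g) (hfg : Function.Exact f g)
    (h' : Function.Exact (B.act N') (A.act N')) (hC : Function.Exact (C.act N') (B.act N'))
    (h'' : Function.Exact (C.act N'') (B.act N'')) :
    Function.Exact (B.act N) (A.act N) := by
  intro v
  constructor
  · intro hv
    obtain ⟨t, ht⟩ := (h' (fun j => f (v j))).1 (by
      rw [Matrix.act_comp, hv]
      funext i
      exact map_zero f)
    obtain ⟨w, hw⟩ := (h'' (fun j => g (t j))).1 (by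
      rw [Matrix.act_comp, ht]
      funext i
      exact (hfg _).2 ⟨_, rfl⟩)
    choose w' hw' using fun j => hg (w j)
    -- Subtracting the boundary `C.act N' w'` moves the preimage `t` into `N` and leaves its image
    -- under `B` unchanged.
    have hker : ∀ j, g ((t - C.act N' w') j) = 0 := by
      intro j
      have h1 := congrFun (Matrix.act_comp C g w') j
      rw [show (fun j => g (w' j)) = w from funext hw'] at h1
      rw [Pi.sub_apply, map_sub, ← h1, hw, sub_self]
    choose u hu using fun j => (hfg _).1 (hker j)
    refine ⟨u, funext fun i => hf ?_⟩
    have h1 := congrFun (Matrix.act_comp B f u) i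
    rw [← h1, show (fun j => f (u j)) = t - C.act N' w' from funext hu, map_sub, (hC _).2 ⟨_, rfl⟩,
      sub_zero, ht]
  · rintro ⟨u, rfl⟩
    funext i
    refine hf ?_
    have h1 := congrFun (Matrix.act_comp A f (B.act N u)) i
    rw [← h1, ← Matrix.act_comp, (h' _).2 ⟨_, rfl⟩]
    exact (map_zero f).symm

end MatrixAction

/-! ### Tensor products with the kernel of a matrix -/

section TensorKernel

variable {R : Type u} [CommRing R] {a b c d : ℕ} (A : Matrix (Fin a) (Fin b) R)
  (B : Matrix (Fin b) (Fin c) R) (C : Matrix (Fin c) (Fin d) R)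
  (N : Type u) [AddCommGroup N] [Module R N] {N' : Type u} [AddCommGroup N'] [Module R N']

/-- The canonical map `N ⊗ ker A → N^b`. -/
def Matrix.tensorKer : N ⊗[R] LinearMap.ker (A.act R) →ₗ[R] (Fin b → N) :=
  LinearMap.pi fun i => (TensorProduct.rid R N).toLinearMap ∘ₗ
    LinearMap.lTensor N (LinearMap.proj i ∘ₗ (LinearMap.ker (A.act R)).subtype)

lemma Matrix.tensorKer_tmul (n : N) (m : LinearMap.ker (A.act R)) (i : Fin b) :
    A.tensorKer N (n ⊗ₜ m) i = m.1 i • n := by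
  simp [Matrix.tensorKer]

lemma Matrix.tensorKer_rTensor (f : N →ₗ[R] N') (t : N ⊗[R] LinearMap.ker (A.act R)) :
    A.tensorKer N' (LinearMap.rTensor _ f t) = fun i => f (A.tensorKer N t i) := by
  induction t using TensorProduct.induction_on with
  | zero =>
    funext i
    simp
  | add x y hx hy =>
    funext i
    simp [hx, hy]
  | tmul n m =>
    funext i
    simp [Matrix.tensorKer_tmul]

variable {A B C N}

/-- If the complex of matrices is exact on `R` and on `N`, then `N ⊗ ker A` is the kernel of `A`
on `N^b`. -/
lemma Matrix.tensorKer_injective_and_range (hBA : Function.Exact (B.act R) (A.act R))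
    (hCB : Function.Exact (C.act R) (B.act R)) (hBA' : Function.Exact (B.act N) (A.act N))
    (hCB' : Function.Exact (C.act N) (B.act N)) :
    Function.Injective (A.tensorKer N) ∧
      LinearMap.range (A.tensorKer N) = LinearMap.ker (A.act N) := by
  classical
  -- The columns of `B` generate `ker A` and those of `C` generate their relations. So `N ⊗ ker A`
  -- is the cokernel of `C` on `N^c`, which exactness on `N` identifies with the range of `B`, that
  -- is with the kernel of `A` on `N^b`.
  let β : Fin c → LinearMap.ker (A.act R) := fun j =>
    ⟨B.act R (Pi.single j 1), (hBA _).2 ⟨_, rfl⟩⟩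
  have hβ : ∀ j i, (β j).1 i = B i j := fun j i => by
    simp [β, Matrix.act_single]
  have hι : ∀ v : Fin c → N, A.tensorKer N (∑ j, v j ⊗ₜ β j) = B.act N v := by
    intro v
    funext i
    rw [map_sum, Finset.sum_apply, Matrix.act_apply]
    exact Finset.sum_congr rfl fun j _ => by rw [Matrix.tensorKer_tmul, hβ]
  have hsum : ∀ u : Fin c → R, (∑ j, u j • β j).1 = B.act R u := by
    intro u
    funext i
    rw [Matrix.act_apply, Submodule.coe_sum, Finset.sum_apply]
    refine Finset.sum_congr rfl fun j _ => ?_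
    rw [Submodule.coe_smul, Pi.smul_apply, hβ, smul_eq_mul, smul_eq_mul, mul_comm]
  have hsurj : ∀ t : N ⊗[R] LinearMap.ker (A.act R), ∃ v : Fin c → N, ∑ j, v j ⊗ₜ β j = t := by
    intro t
    induction t using TensorProduct.induction_on with
    | zero => exact ⟨0, by simp⟩
    | add x y hx hy =>
      obtain ⟨v, rfl⟩ := hx
      obtain ⟨w, rfl⟩ := hy
      exact ⟨v + w, by simp [TensorProduct.add_tmul, Finset.sum_add_distrib]⟩
    | tmul n m =>
      obtain ⟨u, hu⟩ := (hBA m.1).1 m.2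
      refine ⟨fun j => u j • n, ?_⟩
      simp only [TensorProduct.smul_tmul]
      rw [← TensorProduct.tmul_sum]
      congr 1
      exact Subtype.ext ((hsum u).trans hu)
  refine ⟨(injective_iff_map_eq_zero _).2 fun t ht => ?_, le_antisymm ?_ ?_⟩
  · obtain ⟨v, rfl⟩ := hsurj t
    rw [hι] at ht
    obtain ⟨w, rfl⟩ := (hCB' v).1 ht
    simp only [Matrix.act_apply, TensorProduct.sum_tmul, TensorProduct.smul_tmul]
    rw [Finset.sum_comm]
    refine Finset.sum_eq_zero fun k _ => ?_
    rw [← TensorProduct.tmul_sum]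
    have h0 : ∑ j, C j k • β j = 0 := by
      refine Subtype.ext ((hsum fun j => C j k).trans ?_)
      have h1 := (hCB _).2 ⟨Pi.single k (1 : R), rfl⟩
      rw [Matrix.act_single] at h1
      simpa using h1
    rw [h0, TensorProduct.tmul_zero]
  · rintro _ ⟨t, rfl⟩
    obtain ⟨v, rfl⟩ := hsurj t
    rw [hι]
    exact (hBA' _).2 ⟨v, rfl⟩
  · intro v hv
    obtain ⟨w, rfl⟩ := (hBA' v).1 hv
    exact ⟨_, hι w⟩

end TensorKernel

/-- A complete resolution by finite free modules: an exact complex of matrices over `R` indexed by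
`ℤ` whose transpose is exact as well. -/
structure CompleteResolution (R : Type u) [CommRing R] where
  /-- the ranks of the free modules -/
  rank : ℤ → ℕ
  /-- the matrices of the differentials -/
  mat : ∀ n, Matrix (Fin (rank (n + 1))) (Fin (rank n)) R
  exact : ∀ n, Function.Exact ((mat n).act R) ((mat (n + 1)).act R)
  exact_transpose : ∀ n,
    Function.Exact ((mat (n + 1)).transpose.act R) ((mat n).transpose.act R)

namespace CompleteResolution

variable {R : Type u} [CommRing R] (P : CompleteResolution R)

/-- The module of cocycles of a complete resolution in degree `0`. -/
abbrev cocycles : Type u := LinearMap.ker ((P.mat 0).act R)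

/-- A complete resolution stays exact on `N`. -/
def ExactOn (N : Type u) [AddCommGroup N] [Module R N] : Prop :=
  ∀ n, Function.Exact ((P.mat n).act N) ((P.mat (n + 1)).act N)

variable {P}

/-- The matrices acting on `N` form `Hom(-, N)` of the transposed complex, which is exact by
definition of a complete resolution. -/
lemma exactOn_of_injective {N : Type u} [AddCommGroup N] [Module R N]
    (hN : Module.Injective R N) : P.ExactOn N := fun n => by
  simpa using Matrix.exact_act_injective hN (P.exact_transpose n)

lemma exactOn_of_shortExact {N N' N'' : Type u} [AddCommGroup N] [Module R N] [AddCommGroup N']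
    [Module R N'] [AddCommGroup N''] [Module R N''] {f : N →ₗ[R] N'} {g : N' →ₗ[R] N''}
    (hf : Function.Injective f) (hg : Function.Surjective g) (hfg : Function.Exact f g)
    (h' : P.ExactOn N') (h'' : P.ExactOn N'') : P.ExactOn N := fun n => by
  obtain ⟨k, rfl⟩ : ∃ k, n = k + 1 := ⟨n - 1, by ring⟩
  exact Matrix.exact_act_of_shortExact hf hg hfg (h' _) (h' _) (h'' _)

lemma ExactOn.tensorKer_injective_and_range {N : Type u} [AddCommGroup N] [Module R N]
    (h : P.ExactOn N) : Function.Injective ((P.mat 0).tensorKer N) ∧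
      LinearMap.range ((P.mat 0).tensorKer N) = LinearMap.ker ((P.mat 0).act N) :=
  Matrix.tensorKer_injective_and_range (P.exact (-1)) (P.exact (-2)) (h (-1)) (h (-2))

/-- If `P` is exact on `N` and on the target of an injection `f : N → N'`, then
`f ⊗ cocycles` is injective. -/
lemma rTensor_injective {N N' : Type u} [AddCommGroup N] [Module R N] [AddCommGroup N']
    [Module R N'] (h : P.ExactOn N) {f : N →ₗ[R] N'} (hf : Function.Injective f) :
    Function.Injective (LinearMap.rTensor P.cocycles f) := by
  intro x y hxy
  -- Inside a finite power of `N` the map becomes `f` on each coordinate.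
  apply h.tensorKer_injective_and_range.1
  have h1 := Matrix.tensorKer_rTensor (P.mat 0) N f x
  rw [hxy, Matrix.tensorKer_rTensor] at h1
  funext i
  exact hf (congrFun h1 i).symm

/-- The complex `T ⊗ P`. -/
def complex (T : Type u) [AddCommGroup T] [Module R T] (h : P.ExactOn T) :
    CochainComplex (ModuleCat.{u} R) ℤ :=
  CochainComplex.of (fun n => ModuleCat.of R (Fin (P.rank n) → T))
    (fun n => ModuleCat.ofHom ((P.mat n).act T)) fun n =>
      ModuleCat.hom_ext (LinearMap.ext fun v => (h n _).2 ⟨v, rfl⟩)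

lemma complex_d (T : Type u) [AddCommGroup T] [Module R T] (h : P.ExactOn T) (n : ℤ) :
    (P.complex T h).d n (n + 1) = ModuleCat.ofHom ((P.mat n).act T) :=
  CochainComplex.of_d (fun n => ModuleCat.of R (Fin (P.rank n) → T))
    (fun n => ModuleCat.ofHom ((P.mat n).act T)) n

/-- If `T` is injective then `T ⊗ cocycles` is Gorenstein injective. -/
lemma isGorensteinInjective_tensor (P : CompleteResolution R) {T : Type u} [AddCommGroup T]
    [Module R T] (hT : Module.Injective R T) {N : ModuleCat.{u} R}
    (e : T ⊗[R] P.cocycles ≃ₗ[R] N) : IsGorensteinInjective R N := by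
  have hex : P.ExactOn T := exactOn_of_injective hT
  refine ⟨P.complex T hex, fun n => ?_, fun n => ?_, fun I hI n => ?_, ?_⟩
  · exact Module.Injective.pi R fun _ : Fin (P.rank n) => T
  · rw [complex_d, complex_d]
    exact hex n
  · rw [complex_d, complex_d]
    -- The transposed complex is exact on the injective module `I`; applying `Hom(-, T)` with `T`
    -- injective transposes back and gives exactness on `Hom(I, T)`.
    have h1 := Matrix.exact_act_injective hI (P.exact n)
    have h2 := Matrix.exact_act_hom hT h1
    rw [Matrix.transpose_transpose, Matrix.transpose_transpose] at h2
    intro (f : I →ₗ[R] Fin (P.rank (n + 1)) → T)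
    have hact : ∀ {k m : ℕ} (A : Matrix (Fin m) (Fin k) R) (g : I →ₗ[R] Fin k → T),
        LinearMap.pi (A.act (I →ₗ[R] T) fun j => LinearMap.proj j ∘ₗ g) = A.act T ∘ₗ g := by
      intro k m A g
      refine LinearMap.ext fun x => funext fun i => ?_
      simp [Matrix.act_apply]
    have hpi : ∀ {k : ℕ} (g : I →ₗ[R] Fin k → T),
        LinearMap.pi (fun j => LinearMap.proj j ∘ₗ g) = g :=
      fun g => rfl
    constructor
    · intro hf
      change (P.mat (n + 1)).act T ∘ₗ f = 0 at hf
      obtain ⟨w, hw⟩ := (h2 fun j => LinearMap.proj j ∘ₗ f).1 (by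
        funext i
        have h3 := congrArg (fun g => LinearMap.proj i ∘ₗ g) ((hact (P.mat (n + 1)) f).trans hf)
        simpa using h3)
      refine ⟨LinearMap.pi w, ?_⟩
      change (P.mat n).act T ∘ₗ LinearMap.pi w = f
      rw [← hact, ← hpi f, ← hw]
      rfl
    · rintro ⟨g, rfl⟩
      refine LinearMap.ext fun x => ?_
      exact (hex n _).2 ⟨g x, rfl⟩
  · obtain ⟨hinj, hrange⟩ := hex.tensorKer_injective_and_range
    have h0 : LinearMap.ker ((P.complex T hex).d 0 1).hom = LinearMap.ker ((P.mat 0).act T) := by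
      rw [show (P.complex T hex).d 0 1 = ModuleCat.ofHom ((P.mat 0).act T) from complex_d T hex 0]
      rfl
    exact ⟨(e.symm.trans (LinearEquiv.ofInjective _ hinj)).trans
      (LinearEquiv.ofEq _ _ (hrange.trans h0.symm))⟩

end CompleteResolution

/-! ### Local rings over which the residue field has finite projective dimension -/

section ResidueFieldExt

variable {R : Type u} [CommRing R]

lemma subsingleton_ext_of_linearEquiv_right {X Y Z : ModuleCat.{u} R} {j : ℕ}
    (h : Subsingleton (Ext X Y j)) (f : Y ≃ₗ[R] Z) : Subsingleton (Ext X Z j) := by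
  have h0 : ∀ e : Ext X Z j, e = 0 := fun e => by
    have h1 := congrArg (fun t => t.comp (Ext.mk₀ f.toModuleIso.hom) (add_zero j))
      (Subsingleton.elim (e.comp (Ext.mk₀ f.toModuleIso.inv) (add_zero j)) 0)
    have h2 : f.toModuleIso.inv ≫ f.toModuleIso.hom = 𝟙 Z := f.toModuleIso.inv_hom_id
    simpa only [Ext.comp_assoc_of_third_deg_zero, Ext.mk₀_comp_mk₀, h2, Ext.comp_mk₀_id,
      Ext.zero_comp] using h1
  exact ⟨fun a b => (h0 a).trans (h0 b).symm⟩

/-- `Ext^j(X, L)` vanishes for a finitely generated module `L` as soon as `Ext^j(X, R/q)` does for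
all primes `q` in the support of `L`. -/
lemma subsingleton_ext_of_forall_prime_right [IsNoetherianRing R] {X : ModuleCat.{u} R} {j : ℕ}
    (L : ModuleCat.{u} R) [hL : Module.Finite R L]
    (h : ∀ q : PrimeSpectrum R, q ∈ Module.support R L →
      Subsingleton (Ext X (ModuleCat.of R (R ⧸ q.asIdeal)) j)) : Subsingleton (Ext X L j) := by
  suffices key : ∀ (M : Type u) [AddCommGroup M] [Module R M] (_ : Module.Finite R M),
      (∀ q : PrimeSpectrum R, q ∈ Module.support R M →
        Subsingleton (Ext X (ModuleCat.of R (R ⧸ q.asIdeal)) j)) →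
      Subsingleton (Ext X (ModuleCat.of R M) j) from key L hL h
  intro M _ _ hM
  induction hM using IsNoetherianRing.induction_on_isQuotientEquivQuotientPrime R with
  | subsingleton M =>
    intro _
    have h0 : 𝟙 (ModuleCat.of R M) = 0 := by
      ext x
      exact Subsingleton.elim (α := M) _ _
    have h1 : ∀ e : Ext X (ModuleCat.of R M) j, e = 0 := fun e => by
      rw [← Ext.comp_mk₀_id e, h0, Ext.mk₀_zero, Ext.comp_zero]
    exact ⟨fun a b => (h1 a).trans (h1 b).symm⟩
  | quotient M p f =>
    intro h
    refine subsingleton_ext_of_linearEquiv_right (Y := ModuleCat.of R (R ⧸ p.asIdeal))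
      (Z := ModuleCat.of R M) (h p ?_) f.symm
    rw [f.support_eq, Module.support_eq_zeroLocus, Ideal.annihilator_quotient]
    exact fun _ h => h
  | exact M₁ M₂ M₃ f g hf hg hfg h₁ h₃ =>
    intro h
    exact extTorsion_bot_iff.1 (ExtTorsion.middle_right (exactComplex_shortExact hfg hf hg)
      (extTorsion_bot_iff.2 (h₁ fun q hq => h q (Module.support_subset_of_injective f hf hq)))
      (extTorsion_bot_iff.2 (h₃ fun q hq => h q (Module.support_subset_of_surjective g hg hq))))

lemma ext_smul_eq_zero_of_mem_annihilator {X N : ModuleCat.{u} R} {j : ℕ} {s : R}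
    (h : s ∈ Module.annihilator R X) (e : Ext X N j) : s • e = 0 := by
  have h0 : s • 𝟙 X = 0 := by
    ext x
    exact Module.mem_annihilator.1 h x
  rw [ext_smul_eq_mk₀_smul_comp, h0, Ext.mk₀_zero, Ext.zero_comp]

variable [IsLocalRing R] [IsNoetherianRing R]

open IsLocalRing

/-- If `Ext^j(k, k) = 0` for the residue field `k`, then `k` has finite projective dimension. -/
lemma hasProjectiveDimensionLT_residueField {j : ℕ}
    (h : Subsingleton (Ext (ModuleCat.of R (ResidueField R)) (ModuleCat.of R (ResidueField R)) j)) :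
    HasProjectiveDimensionLT (ModuleCat.of R (ResidueField R)) j := by
  have : Module.Finite R (ModuleCat.of R (ResidueField R)) :=
    inferInstanceAs (Module.Finite R (R ⧸ maximalIdeal R))
  refine ModuleCat.hasProjectiveDimensionLT_of_forall_finite _ _ fun L _ =>
    subsingleton_ext_of_forall_prime_right L fun q hq => ?_
  clear hq
  have : WellFoundedGT (PrimeSpectrum R) :=
    StrictMono.wellFoundedGT (f := PrimeSpectrum.asIdeal) fun _ _ h => h
  induction q using WellFoundedGT.induction with
  | ind q ih =>
  by_cases hq : maximalIdeal R ≤ q.asIdeal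
  · obtain rfl : q = closedPoint R :=
      PrimeSpectrum.ext (le_antisymm (le_maximalIdeal q.2.ne_top) hq)
    exact h
  -- By induction `Ext^j(k, -)` vanishes on the cokernel of `x` on `R/q`, so `x` acts surjectively
  -- on `Ext^j(k, R/q)`. But `x` lies in the maximal ideal and kills `k`.
  obtain ⟨x, hxm, hxq⟩ := Set.not_subset.1 hq
  have hreg := isSMulRegular_quotient_prime q hxq
  let X := ModuleCat.of R (R ⧸ q.asIdeal)
  have hS : (X.smulShortComplex x).ShortExact := hreg.smulShortComplex_shortExact
  have h3 : Subsingleton (Ext (ModuleCat.of R (ResidueField R)) (X.smulShortComplex x).X₃ j) :=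
    subsingleton_ext_of_forall_prime_right (ModuleCat.of R (QuotSMulTop x X)) fun q' hq' =>
      ih q' (lt_of_mem_support_quotSMulTop hxq hq')
  have h0 : ∀ e : Ext (ModuleCat.of R (ResidueField R)) (X.smulShortComplex x).X₂ j, e = 0 := by
    intro e
    obtain ⟨e', he'⟩ := Ext.covariant_sequence_exact₂ _ hS e (Subsingleton.elim _ _)
    have h1 : e'.comp (Ext.mk₀ (X.smulShortComplex x).f) (add_zero j) = x • (e' : Ext _ X j) :=
      (congrArg (fun t => (e' : Ext _ X j).comp t (add_zero j)) (Ext.mk₀_smul x (𝟙 X))).trans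
        ((Ext.comp_smul _ _ _ _).trans (congrArg (x • ·) (Ext.comp_mk₀_id _)))
    refine (he'.symm.trans h1).trans ?_
    refine ext_smul_eq_zero_of_mem_annihilator
      (Module.mem_annihilator.2 fun (m : ResidueField R) => ?_) _
    rw [Algebra.smul_def, ResidueField.algebraMap_eq, (residue_eq_zero_iff x).2 hxm, zero_mul]
  exact ⟨fun a b => (h0 a).trans (h0 b).symm⟩

end ResidueFieldExt

/-! ### Reduction modulo a regular element -/

section QuotientTensor

variable {R : Type u} [CommRing R] (I : Ideal R) {M N P : Type u} [AddCommGroup M] [Module R M]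
  [AddCommGroup N] [Module R N] [AddCommGroup P] [Module R P]

lemma one_tmul_eq_zero_iff (m : M) : (1 : R ⧸ I) ⊗ₜ[R] m = 0 ↔ m ∈ I • (⊤ : Submodule R M) := by
  rw [← (TensorProduct.quotTensorEquivQuotSMul M I).map_eq_zero_iff,
    TensorProduct.quotTensorEquivQuotSMul_mk_one_tmul, Submodule.Quotient.mk_eq_zero]

lemma lTensor_quotient_injective {f : M →ₗ[R] N}
    (h : ∀ m, f m ∈ I • (⊤ : Submodule R N) → m ∈ I • (⊤ : Submodule R M)) :
    Function.Injective (f.lTensor (R ⧸ I)) := by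
  refine (injective_iff_map_eq_zero _).2 fun t ht => ?_
  obtain ⟨m, rfl⟩ := TensorProduct.mk_surjective R M (R ⧸ I) Ideal.Quotient.mk_surjective t
  rw [TensorProduct.mk_apply, LinearMap.lTensor_tmul, one_tmul_eq_zero_iff] at ht
  rw [TensorProduct.mk_apply, one_tmul_eq_zero_iff]
  exact h m ht

/-- If `x` is regular on the ring and on `M`, then the projective dimension of `M / xM` over
`R / x` is at most that of `M`. -/
lemma hasProjectiveDimensionLT_quotient_tensor {x : R} (hx : IsSMulRegular R x) (n : ℕ) :
    ∀ (M : Type u) [AddCommGroup M] [Module R M], IsSMulRegular M x →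
      HasProjectiveDimensionLT (ModuleCat.of R M) n →
      HasProjectiveDimensionLT
        (ModuleCat.of (R ⧸ Ideal.span {x}) ((R ⧸ Ideal.span {x}) ⊗[R] M)) n := by
  induction n with
  | zero =>
    intro M _ _ _ hM
    have := ModuleCat.isZero_iff_subsingleton.1 ((hasProjectiveDimensionLT_zero_iff_isZero _).1 hM)
    have : Subsingleton M := this
    exact (hasProjectiveDimensionLT_zero_iff_isZero _).2 (ModuleCat.isZero_of_subsingleton _)
  | succ n ih =>
    intro M _ _ hreg hM
    match n with
    | 0 =>
      have h1 : Module.Projective R M :=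
        (IsProjective.iff_projective M).2 (projective_iff_hasProjectiveDimensionLT_one.2 hM)
      exact projective_iff_hasProjectiveDimensionLT_one.1
        ((IsProjective.iff_projective _).1 inferInstance)
    | n + 1 =>
      obtain ⟨F, _, _, _, hFreg, f, hf⟩ : ∃ (F : Type u) (_ : AddCommGroup F) (_ : Module R F)
          (_ : Module.Projective R F) (_ : IsSMulRegular F x) (f : F →ₗ[R] M),
          Function.Surjective f :=
        ⟨M →₀ R, inferInstance, inferInstance, inferInstance,
          fun a b hab => Finsupp.ext fun m => hx (DFunLike.congr_fun hab m), _,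
          Finsupp.linearCombination_id_surjective R M⟩
      have hex : Function.Exact (LinearMap.ker f).subtype f := LinearMap.exact_subtype_ker_map f
      have hS := exactComplex_shortExact hex (Submodule.subtype_injective _) hf
      have hF : Projective (ModuleCat.of R F) := (IsProjective.iff_projective _).1 inferInstance
      have hK : HasProjectiveDimensionLT (ModuleCat.of R (LinearMap.ker f)) (n + 1) :=
        (hS.hasProjectiveDimensionLT_X₃_iff n hF).1 hM
      have hK' := ih (LinearMap.ker f)
        (fun a b hab => Subtype.ext (hFreg (congrArg Subtype.val hab))) hK
      let S := R ⧸ Ideal.span {x}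
      let ι : S ⊗[R] LinearMap.ker f →ₗ[S] S ⊗[R] F := (LinearMap.ker f).subtype.baseChange S
      let g : S ⊗[R] F →ₗ[S] S ⊗[R] M := f.baseChange S
      have hιg : Function.Exact ι g := lTensor_exact S hex hf
      have hg : Function.Surjective g := LinearMap.lTensor_surjective S hf
      -- Regularity of `x` on `M` keeps the presentation exact modulo `x`: if `m = x • v` lies in
      -- the kernel of `f`, then `x • f v = 0`, so `v` lies there as well.
      have hι : Function.Injective ι := lTensor_quotient_injective _ fun m hm => by
        rw [Submodule.ideal_span_singleton_smul, Submodule.mem_smul_pointwise_iff_exists] at hm ⊢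
        obtain ⟨v, -, hv⟩ := hm
        have hv0 : f v = 0 := hreg (by
          change x • f v = x • 0
          rw [← map_smul, hv, smul_zero]
          exact m.2)
        exact ⟨⟨v, hv0⟩, trivial, Subtype.ext hv⟩
      have hS' := exactComplex_shortExact hιg hι hg
      have hF' : Projective (ModuleCat.of S (S ⊗[R] F)) :=
        (IsProjective.iff_projective _).1 inferInstance
      exact (hS'.hasProjectiveDimensionLT_X₃_iff n hF').2 hK'

end QuotientTensor

/-! ### Serre's regularity criterion -/

section Serre

open IsLocalRing

/-- If the maximal ideal is an associated prime of the ring, then finitely generated modules of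
finite projective dimension are projective. -/
lemma projective_of_hasProjectiveDimensionLT {R : Type u} [CommRing R] [IsLocalRing R]
    [IsNoetherianRing R] {s : R} (hs : s ≠ 0) (hsm : ∀ x ∈ maximalIdeal R, s * x = 0) (n : ℕ) :
    ∀ (M : Type u) [AddCommGroup M] [Module R M] [Module.Finite R M],
      HasProjectiveDimensionLT (ModuleCat.of R M) n → Module.Projective R M := by
  induction n with
  | zero =>
    intro M _ _ _ hM
    have := ModuleCat.isZero_iff_subsingleton.1 ((hasProjectiveDimensionLT_zero_iff_isZero _).1 hM)
    have : Subsingleton M := this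
    infer_instance
  | succ n ih =>
    intro M _ _ _ hM
    match n with
    | 0 =>
      exact (IsProjective.iff_projective M).2 (projective_iff_hasProjectiveDimensionLT_one.2 hM)
    | n + 1 =>
      obtain ⟨F, _, _, _, _, f, hf⟩ := Module.exists_finite_presentation R M
      have hex : Function.Exact (LinearMap.ker f).subtype f := LinearMap.exact_subtype_ker_map f
      have hS := exactComplex_shortExact hex (Submodule.subtype_injective _) hf
      have hF : Projective (ModuleCat.of R F) := (IsProjective.iff_projective _).1 inferInstance
      have hP : Module.Projective R (LinearMap.ker f) :=
        ih _ ((hS.hasProjectiveDimensionLT_X₃_iff n hF).1 hM)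
      have hfree : Module.Free R (LinearMap.ker f) := Module.free_of_flat_of_isLocalRing
      -- If `m` in the kernel lies in the maximal ideal times `F`, then `s • m = 0`. The kernel is
      -- free, so a unit coordinate of `m` would give `s = 0`; hence all coordinates are nonunits.
      -- Injectivity over the residue field splits the inclusion and makes `M` a summand of `F`.
      have hinj : Function.Injective ((LinearMap.ker f).subtype.lTensor (ResidueField R)) := by
        refine lTensor_quotient_injective (maximalIdeal R) fun m hm => ?_
        have hsmF : ∀ v ∈ maximalIdeal R • (⊤ : Submodule R F), s • v = 0 := fun v hv => by
          refine Submodule.smul_induction_on hv (fun r hr v _ => ?_) fun v w hv hw => ?_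
          · rw [smul_smul, hsm r hr, zero_smul]
          · rw [smul_add, hv, hw, add_zero]
        have hm0 : s • m = 0 := Subtype.ext (hsmF _ hm)
        let b := Module.Free.chooseBasis R (LinearMap.ker f)
        rw [← b.sum_repr m]
        refine Submodule.sum_mem _ fun i _ => Submodule.smul_mem_smul ?_ trivial
        rw [mem_maximalIdeal, mem_nonunits_iff]
        intro hu
        have h1 : s * b.repr m i = 0 := by
          have := DFunLike.congr_fun (congrArg b.repr hm0) i
          simpa using this
        exact hs (hu.mul_left_eq_zero.1 h1)
      have hsplit := (IsLocalRing.split_injective_iff_lTensor_residueField_injective _).2 hinj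
      obtain ⟨l, hl⟩ := ((hex.split_tfae Subtype.val_injective hf).out 0 1).2 hsplit
      exact Module.Projective.of_split l f hl

/-- At most one generator of the maximal ideal is lost when passing to the quotient by an
element. -/
lemma spanFinrank_maximalIdeal_le {R : Type u} [CommRing R] [IsLocalRing R] [IsNoetherianRing R]
    {x : R} (hx : x ∈ maximalIdeal R) [IsLocalRing (R ⧸ Ideal.span {x})] :
    (maximalIdeal R).spanFinrank ≤ (maximalIdeal (R ⧸ Ideal.span {x})).spanFinrank + 1 := by
  classical
  obtain ⟨s, hs, hspan⟩ := Submodule.FG.exists_span_finset_card_eq_spanFinrank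
    (maximalIdeal (R ⧸ Ideal.span {x})).fg_of_isNoetherianRing
  let σ : R ⧸ Ideal.span {x} → R := Function.surjInv Ideal.Quotient.mk_surjective
  have hσ : ∀ y, Ideal.Quotient.mk (Ideal.span {x}) (σ y) = y :=
    Function.surjInv_eq Ideal.Quotient.mk_surjective
  have hmap : (maximalIdeal (R ⧸ Ideal.span {x})).comap (Ideal.Quotient.mk _) = maximalIdeal R :=
    eq_maximalIdeal (Ideal.comap_isMaximal_of_surjective _ Ideal.Quotient.mk_surjective)
  have h1 : maximalIdeal R = Ideal.span (insert x (s.image σ) : Finset R) := by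
    rw [Finset.coe_insert, Finset.coe_image]
    refine le_antisymm (fun y hy => ?_) (Ideal.span_le.2 (Set.insert_subset hx ?_))
    · rw [← hmap, Ideal.mem_comap, ← hspan] at hy
      have hs' : (s : Set (R ⧸ Ideal.span {x})) =
          Ideal.Quotient.mk (Ideal.span {x}) '' (σ '' s) := by
        rw [Set.image_image]
        simp only [hσ, Set.image_id']
      have hy' : Ideal.Quotient.mk (Ideal.span {x}) y ∈
          (Ideal.span (σ '' s)).map (Ideal.Quotient.mk (Ideal.span {x})) := by
        rw [Ideal.map_span, ← hs']
        exact hy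
      obtain ⟨z, hz, hzy⟩ :=
        (Ideal.mem_map_iff_of_surjective _ Ideal.Quotient.mk_surjective).1 hy'
      have h2 := Ideal.Quotient.eq.1 hzy.symm
      rw [← sub_add_cancel y z]
      exact add_mem (Ideal.span_mono (Set.singleton_subset_iff.2 (Set.mem_insert _ _)) h2)
        (Ideal.span_mono (Set.subset_insert _ _) hz)
    · rintro _ ⟨y, hy, rfl⟩
      rw [← hmap]
      rw [SetLike.mem_coe, Ideal.mem_comap, hσ, ← hspan]
      exact Submodule.subset_span hy
  rw [h1]
  refine (Submodule.spanFinrank_span_le_ncard_of_finite (Finset.finite_toSet _)).trans ?_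
  rw [Set.ncard_coe_finset, ← hs]
  exact (Finset.card_insert_le _ _).trans (Nat.add_le_add_right Finset.card_image_le 1)

/-- The residue field of `R / x` is a direct summand of `m / xm` for `x ∈ m \ m²`. -/
lemma exists_retract_residueField {R : Type u} [CommRing R] [IsLocalRing R] {x : R}
    (hx : x ∈ maximalIdeal R) (hx2 : x ∉ maximalIdeal R ^ 2) [IsLocalRing (R ⧸ Ideal.span {x})] :
    Nonempty (Retract (ModuleCat.of (R ⧸ Ideal.span {x}) (ResidueField (R ⧸ Ideal.span {x})))
      (ModuleCat.of (R ⧸ Ideal.span {x}) ((R ⧸ Ideal.span {x}) ⊗[R] maximalIdeal R))) := by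
  let S := R ⧸ Ideal.span {x}
  have hmap : (maximalIdeal S).comap (Ideal.Quotient.mk _) = maximalIdeal R :=
    eq_maximalIdeal (Ideal.comap_isMaximal_of_surjective _ Ideal.Quotient.mk_surjective)
  let v : maximalIdeal R := ⟨x, hx⟩
  have hv : (maximalIdeal R).toCotangent v ≠ 0 := fun h =>
    hx2 ((Ideal.toCotangent_eq_zero _ _).1 h)
  -- As `x ∉ m²`, some functional on `m/m²` is nonzero at the class of `x`; normalized, it gives the
  -- retraction of `1 ↦ 1 ⊗ x`.
  obtain ⟨φ, hφ⟩ : ∃ φ : Module.Dual (ResidueField R) (CotangentSpace R),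
      φ ((maximalIdeal R).toCotangent v) ≠ 0 := by
    by_contra! h
    exact hv ((Module.forall_dual_apply_eq_zero_iff (ResidueField R) _).1 h)
  let ψ : ResidueField R →ₗ[R] ResidueField S :=
    Submodule.liftQ (maximalIdeal R) (Algebra.linearMap R (ResidueField S)) fun r hr => by
      rw [LinearMap.mem_ker, Algebra.linearMap_apply, IsScalarTower.algebraMap_apply R S,
        ResidueField.algebraMap_eq, residue_eq_zero_iff]
      rw [← hmap] at hr
      exact hr
  have hψ : ψ 1 = 1 := by
    have : ψ 1 = algebraMap R (ResidueField S) 1 := rfl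
    rw [this, map_one]
  let χ : maximalIdeal R →ₗ[R] ResidueField S := ψ ∘ₗ
    ((φ ((maximalIdeal R).toCotangent v))⁻¹ • φ).restrictScalars R ∘ₗ (maximalIdeal R).toCotangent
  have hχ : χ v = 1 := by
    have : χ v = ψ ((φ ((maximalIdeal R).toCotangent v))⁻¹ * φ ((maximalIdeal R).toCotangent v)) :=
      rfl
    rw [this, inv_mul_cancel₀ hφ, hψ]
  let π : S ⊗[R] maximalIdeal R →ₗ[S] ResidueField S := LinearMap.liftBaseChange S χ
  let ι : ResidueField S →ₗ[S] S ⊗[R] maximalIdeal R :=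
    quotientToSpan (maximalIdeal S) ((1 : S) ⊗ₜ v) fun r hr => by
      obtain ⟨r, rfl⟩ := Ideal.Quotient.mk_surjective r
      have hr' : r ∈ maximalIdeal R := by
        rw [← hmap]
        exact hr
      have h1 : Ideal.Quotient.mk (Ideal.span {x}) r • ((1 : S) ⊗ₜ[R] v) =
          (1 : S) ⊗ₜ[R] (r • v) := by
        rw [TensorProduct.tmul_smul]
        exact algebraMap_smul S r ((1 : S) ⊗ₜ[R] v)
      have h2 : r • v = x • (⟨r, hr'⟩ : maximalIdeal R) := Subtype.ext (mul_comm r x)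
      rw [h1, h2, one_tmul_eq_zero_iff]
      exact Submodule.smul_mem_smul (Ideal.mem_span_singleton_self x) trivial
  refine ⟨⟨ModuleCat.ofHom ι, ModuleCat.ofHom π, ModuleCat.hom_ext (LinearMap.ext fun y => ?_)⟩⟩
  obtain ⟨s, rfl⟩ := Ideal.Quotient.mk_surjective y
  change π (s • ((1 : S) ⊗ₜ v)) = _
  rw [map_smul, LinearMap.liftBaseChange_tmul, hχ, one_smul, Algebra.smul_def, mul_one]
  rfl

/-- Prime avoidance for `m²`, the one ideal here that need not be prime, and the associated primes.
If `m ⊆ m²`, then `m = 0` by Nakayama and `s = 1` serves; if `m` lies in an associated prime, its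
witness serves. -/
lemma exists_smul_eq_zero_or_exists_isSMulRegular (R : Type u) [CommRing R] [IsLocalRing R]
    [IsNoetherianRing R] : (∃ s : R, s ≠ 0 ∧ ∀ x ∈ maximalIdeal R, s * x = 0) ∨
      ∃ x ∈ maximalIdeal R, x ∉ maximalIdeal R ^ 2 ∧ IsSMulRegular R x := by
  refine or_iff_not_imp_left.2 fun h => ?_
  have hsub : ¬ ((maximalIdeal R : Set R) ⊆
      ⋃ I ∈ insert (maximalIdeal R ^ 2) (associatedPrimes R R), (I : Set R)) := by
    rw [Ideal.subset_union_prime_finite (f := fun I => I) ((associatedPrimes.finite R R).insert _)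
      (maximalIdeal R ^ 2) (maximalIdeal R ^ 2)
      fun I hI hI' _ => (Set.mem_of_mem_insert_of_ne hI hI').1]
    rintro ⟨I, rfl | hI, hle⟩
    · have hbot : maximalIdeal R = ⊥ :=
        Submodule.eq_bot_of_le_smul_of_le_jacobson_bot (maximalIdeal R) _
          (maximalIdeal R).fg_of_isNoetherianRing
          (by rwa [smul_eq_mul, ← pow_two]) (maximalIdeal_le_jacobson _)
      refine h ⟨1, one_ne_zero, fun x hx => ?_⟩
      rw [hbot, Ideal.mem_bot] at hx
      rw [hx, mul_zero]
    · obtain ⟨s, hs⟩ := IsAssociatedPrime.exists_smul_eq_zero_iff hI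
      refine h ⟨s, ?_, fun x hx => ?_⟩
      · rintro rfl
        exact hI.1.ne_top ((Ideal.eq_top_iff_one _).2 ((hs 1).1 (smul_zero _)))
      · rw [mul_comm]
        exact (hs x).2 (hle hx)
  obtain ⟨x, hx, hx'⟩ := Set.not_subset.1 hsub
  rw [Set.biUnion_insert, Set.mem_union, not_or] at hx'
  refine ⟨x, hx, hx'.1, ?_⟩
  have h2 := hx'.2
  rw [biUnion_associatedPrimes_eq_compl_nonZeroDivisors, Set.notMem_compl_iff] at h2
  exact Module.Flat.isSMulRegular_of_nonZeroDivisors h2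

/-- The residue field is projective, hence free, hence faithful. As the maximal ideal annihilates
it, that ideal is zero. -/
lemma isRegularLocalRing_of_smul_maximalIdeal_eq_zero {R : Type u} [CommRing R] [IsLocalRing R]
    [IsNoetherianRing R] {s : R} (hs : s ≠ 0) (hsm : ∀ x ∈ maximalIdeal R, s * x = 0) {n : ℕ}
    (hn : HasProjectiveDimensionLT (ModuleCat.of R (ResidueField R)) n) :
    IsRegularLocalRing R := by
  have : Module.Finite R (ResidueField R) := inferInstanceAs (Module.Finite R (R ⧸ maximalIdeal R))
  have hP := projective_of_hasProjectiveDimensionLT hs hsm n (ResidueField R) hn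
  have hfree : Module.Free R (ResidueField R) := Module.free_of_flat_of_isLocalRing
  have hbot : maximalIdeal R = ⊥ := by
    refine eq_bot_iff.2 fun x hx => ?_
    rw [← (Module.annihilator_eq_bot (R := R) (M := ResidueField R)).2 inferInstance,
      Module.mem_annihilator]
    intro m
    rw [Algebra.smul_def, ResidueField.algebraMap_eq, (residue_eq_zero_iff x).2 hx, zero_mul]
  refine IsRegularLocalRing.of_spanFinrank_maximalIdeal_le R ?_
  rw [hbot, Submodule.spanFinrank_bot]
  exact ringKrullDim_nonneg_of_nontrivial

/-- A Noetherian local ring whose residue field has finite projective dimension is regular. -/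
lemma isRegularLocalRing_of_hasProjectiveDimensionLT (d : ℕ) : ∀ (R : Type u) [CommRing R]
    [IsLocalRing R] [IsNoetherianRing R], ringKrullDim R = d → ∀ n,
    HasProjectiveDimensionLT (ModuleCat.of R (ResidueField R)) n → IsRegularLocalRing R := by
  induction d with
  | zero =>
    intro R _ _ _ hd n hn
    obtain ⟨s, hs, hsm⟩ | ⟨x, hx, hx2, hreg⟩ := exists_smul_eq_zero_or_exists_isSMulRegular R
    · exact isRegularLocalRing_of_smul_maximalIdeal_eq_zero hs hsm hn
    · have h1 := ringKrullDim_quotient_span_singleton_succ_eq_ringKrullDim hreg hx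
      rw [hd, Nat.cast_zero] at h1
      have : Nontrivial (R ⧸ Ideal.span {x}) := Ideal.Quotient.nontrivial_iff.2
        fun h => (maximalIdeal.isMaximal R).ne_top
          (top_le_iff.1 (h ▸ (Ideal.span_singleton_le_iff_mem _).2 hx))
      have h2 := ringKrullDim_nonneg_of_nontrivial (R := R ⧸ Ideal.span {x})
      rw [(ENat.WithBot.add_one_le_zero_iff _).1 h1.le] at h2
      exact absurd h2 (by simp)
  | succ d ih =>
    intro R _ _ _ hd n hn
    obtain ⟨s, hs, hsm⟩ | ⟨x, hx, hx2, hreg⟩ := exists_smul_eq_zero_or_exists_isSMulRegular R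
    · exact isRegularLocalRing_of_smul_maximalIdeal_eq_zero hs hsm hn
    have h1 := ringKrullDim_quotient_span_singleton_succ_eq_ringKrullDim hreg hx
    have : Nontrivial (R ⧸ Ideal.span {x}) := Ideal.Quotient.nontrivial_iff.2
      fun h => (maximalIdeal.isMaximal R).ne_top
        (top_le_iff.1 (h ▸ (Ideal.span_singleton_le_iff_mem _).2 hx))
    have : IsLocalRing (R ⧸ Ideal.span {x}) :=
      IsLocalRing.of_surjective' (Ideal.Quotient.mk (Ideal.span {x})) Ideal.Quotient.mk_surjective
    have hd' : ringKrullDim (R ⧸ Ideal.span {x}) = d := by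
      rw [hd] at h1
      exact le_antisymm
        (ENat.WithBot.add_le_add_natCast_right_iff (c := 1).1 (by simpa using h1.le))
        (ENat.WithBot.add_le_add_natCast_right_iff (c := 1).1 (by simpa using h1.ge))
    -- Finite projective dimension passes from `k` to `m`, then to `m/xm` over `R/x`, then to its
    -- direct summand `k`. So `R/x` is regular, and `x` adds at most one generator of `m` while the
    -- dimension grows by one.
    have hm : HasProjectiveDimensionLT (ModuleCat.of R (maximalIdeal R)) (n + 1) := by
      have hex : Function.Exact (maximalIdeal R).subtype (maximalIdeal R).mkQ :=
        LinearMap.exact_subtype_mkQ _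
      have hS := exactComplex_shortExact hex (Submodule.subtype_injective _)
        (Submodule.mkQ_surjective _)
      have hF : Projective (ModuleCat.of R R) := (IsProjective.iff_projective _).1 inferInstance
      exact (hS.hasProjectiveDimensionLT_X₃_iff n hF).1
        (hasProjectiveDimensionLT_of_ge (ModuleCat.of R (ResidueField R)) n (n + 2) (by lia))
    have hS := hasProjectiveDimensionLT_quotient_tensor hreg (n + 1) (maximalIdeal R)
      (fun a b hab => Subtype.ext (hreg (congrArg Subtype.val hab))) hm
    obtain ⟨r⟩ := exists_retract_residueField hx hx2
    have hreg' := ih (R ⧸ Ideal.span {x}) hd' (n + 1) (r.hasProjectiveDimensionLT (n + 1))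
    refine IsRegularLocalRing.of_spanFinrank_maximalIdeal_le R ?_
    rw [← h1, ← (isRegularLocalRing_iff _).1 hreg']
    exact_mod_cast spanFinrank_maximalIdeal_le hx

/-- A Noetherian local ring with residue field `k` such that some `Ext^j(k, k)` vanishes is
regular. -/
lemma isRegularLocalRing_of_subsingleton_ext {R : Type u} [CommRing R] [IsLocalRing R]
    [IsNoetherianRing R] {j : ℕ} (h : Subsingleton
      (Ext (ModuleCat.of R (ResidueField R)) (ModuleCat.of R (ResidueField R)) j)) :
    IsRegularLocalRing R := by
  obtain ⟨d, hd⟩ : ∃ d : ℕ, ringKrullDim R = d := by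
    obtain ⟨d, hd⟩ := ENat.ne_top_iff_exists.1
      (Ideal.height_ne_top (maximalIdeal.isMaximal R).ne_top)
    exact ⟨d, by rw [← maximalIdeal_height_eq_ringKrullDim, ← hd]; rfl⟩
  exact isRegularLocalRing_of_hasProjectiveDimensionLT d R hd j
    (hasProjectiveDimensionLT_residueField h)

end Serre

/-! ### Existence of complete resolutions -/

section Covers

variable {R : Type u} [CommRing R]

/-- The cokernel of a matrix. -/
abbrev Matrix.coker {a b : ℕ} (A : Matrix (Fin a) (Fin b) R) : Type u :=
  (Fin a → R) ⧸ LinearMap.range (A.act R)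

/-- Every submodule of a finite free module over a Noetherian ring is the range of a matrix which
kills a vector with zero annihilator. -/
lemma exists_matrix_range_eq [IsNoetherianRing R] {n : ℕ} (Z : Submodule R (Fin n → R)) :
    ∃ (k : ℕ) (B : Matrix (Fin n) (Fin k) R), LinearMap.range (B.act R) = Z ∧
      ∃ w, B.act R w = 0 ∧ ∀ r : R, r • w = 0 → r = 0 := by
  obtain ⟨k, v, hv⟩ := Submodule.fg_iff_exists_fin_generating_family.1 (IsNoetherian.noetherian Z)
  -- A zero column is prepended to a matrix of generators. The range is unchanged, while the first
  -- basis vector enters the kernel; this is what gives the syzygies full support.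
  refine ⟨k + 1, Matrix.of fun i j => (Fin.cons 0 v : Fin (k + 1) → Fin n → R) j i, ?_,
    Pi.single 0 1, ?_, fun r hr => ?_⟩
  · have hact : ∀ u : Fin (k + 1) → R,
        (Matrix.of fun i j => (Fin.cons 0 v : Fin (k + 1) → Fin n → R) j i).act R u =
          Fintype.linearCombination R (Fin.cons 0 v : Fin (k + 1) → Fin n → R) u := fun u => by
      ext i
      simp [Matrix.act_apply, Fintype.linearCombination_apply, mul_comm]
    rw [LinearMap.ext hact, Fintype.range_linearCombination, Fin.range_cons,
      Submodule.span_insert_zero, hv]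
  · rw [Matrix.act_single]
    ext i
    simp
  · simpa using congrFun hr 0

lemma subsingleton_ext_pi {X : ModuleCat.{u} R} {N : Type u} [AddCommGroup N] [Module R N] {j : ℕ}
    (h : Subsingleton (Ext X (ModuleCat.of R N) j)) (m : ℕ) :
    Subsingleton (Ext X (ModuleCat.of R (Fin m → N)) j) := by
  classical
  let π : ∀ i : Fin m, (Fin m → N) →ₗ[R] N := LinearMap.proj
  let ι : ∀ i : Fin m, N →ₗ[R] (Fin m → N) := LinearMap.single R fun _ => N
  have key : ∀ (e : Ext X (ModuleCat.of R (Fin m → N)) j) (s : Finset (Fin m)),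
      e.comp (Ext.mk₀ (ModuleCat.ofHom (∑ i ∈ s, ι i ∘ₗ π i))) (add_zero j) = 0 := by
    intro e s
    induction s using Finset.induction_on with
    | empty => rw [Finset.sum_empty, ModuleCat.ofHom_zero, Ext.mk₀_zero, Ext.comp_zero]
    | insert i s hi ih =>
      have h0 := Subsingleton.elim (e.comp (Ext.mk₀ (ModuleCat.ofHom (π i))) (add_zero j)) 0
      rw [Finset.sum_insert hi, ModuleCat.ofHom_add, Ext.mk₀_add, Ext.comp_add, ih, add_zero,
        ModuleCat.ofHom_comp, ← Ext.mk₀_comp_mk₀, ← Ext.comp_assoc_of_third_deg_zero, h0,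
        Ext.zero_comp]
  have h1 : ∑ i, ι i ∘ₗ π i = LinearMap.id := by
    refine LinearMap.ext fun v => ?_
    simp only [ι, π, LinearMap.sum_apply, LinearMap.comp_apply, LinearMap.proj_apply,
      LinearMap.coe_single, LinearMap.id_apply]
    exact Finset.univ_sum_single v
  have h2 : ∀ e : Ext X (ModuleCat.of R (Fin m → N)) j, e = 0 := fun e => by
    have h3 := key e Finset.univ
    rwa [h1, ModuleCat.ofHom_id, Ext.comp_mk₀_id] at h3
  exact ⟨fun a b => (h2 a).trans (h2 b).symm⟩

variable {a b c : ℕ} {A : Matrix (Fin a) (Fin b) R} {B : Matrix (Fin b) (Fin c) R}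

/-- The map induced by `A` on the cokernel of `B` if `AB = 0`. -/
def Matrix.cokerMap (h : Function.Exact (B.act R) (A.act R)) : B.coker →ₗ[R] (Fin a → R) :=
  (LinearMap.range (B.act R)).liftQ (A.act R)
    (show LinearMap.range (B.act R) ≤ LinearMap.ker (A.act R) from fun _ hv => (h _).2 hv)

lemma Matrix.coker_shortExact (h : Function.Exact (B.act R) (A.act R)) :
    ∃ hex, (exactComplex (Matrix.cokerMap h) (LinearMap.range (A.act R)).mkQ hex).ShortExact := by
  have hex : Function.Exact (Matrix.cokerMap h) (LinearMap.range (A.act R)).mkQ := by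
    rw [LinearMap.exact_iff, Submodule.ker_mkQ, Matrix.cokerMap, Submodule.range_liftQ]
  refine ⟨hex, exactComplex_shortExact hex ?_ (Submodule.mkQ_surjective _)⟩
  exact LinearMap.ker_eq_bot.1 (Submodule.ker_liftQ_eq_bot _ _ _ fun v hv => (h v).1 hv)

/-- The cokernel of `B` is the image of `A`, the first syzygy of the cokernel of `A`. -/
lemma Matrix.subsingleton_ext_coker (h : Function.Exact (B.act R) (A.act R)) {N : ModuleCat.{u} R}
    {j : ℕ} (hA : Subsingleton (Ext (ModuleCat.of R A.coker) N (j + 1 + 1))) :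
    Subsingleton (Ext (ModuleCat.of R B.coker) N (j + 1)) := by
  obtain ⟨hex, hS⟩ := Matrix.coker_shortExact h
  have hP : Projective (ModuleCat.of R (Fin a → R)) :=
    (IsProjective.iff_projective _).1 inferInstance
  exact extTorsion_bot_iff.1 (ExtTorsion.left_of_succ hS
    (extTorsion_of_subsingleton (Ext.subsingleton_of_projective (ModuleCat.of R (Fin a → R)) N j))
    (extTorsion_of_subsingleton hA))

lemma Matrix.sum_transpose_act_mul (w : Fin a → R) (v : Fin b → R) :
    ∑ j, A.transpose.act R w j * v j = ∑ i, w i * A.act R v i := by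
  simp only [Matrix.act_apply, Matrix.transpose_apply, smul_eq_mul, Finset.sum_mul, Finset.mul_sum]
  rw [Finset.sum_comm]
  exact Finset.sum_congr rfl fun i _ => Finset.sum_congr rfl fun j _ => by ring

/-- The transpose of an exact pair of matrices is exact if `Ext^1(coker A, R) = 0`. -/
lemma Matrix.exact_transpose_act (h : Function.Exact (B.act R) (A.act R))
    (hA : Subsingleton (Ext (ModuleCat.of R A.coker) (ModuleCat.of R R) 1)) :
    Function.Exact (A.transpose.act R) (B.transpose.act R) := by
  classical
  intro w
  constructor
  · intro hw
    let ℓ : (Fin b → R) →ₗ[R] R := ∑ j, w j • LinearMap.proj j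
    have hℓ : ∀ v, ℓ v = ∑ j, w j * v j := fun v => by simp [ℓ]
    let g : B.coker →ₗ[R] R := (LinearMap.range (B.act R)).liftQ ℓ (by
      rintro _ ⟨v, rfl⟩
      rw [LinearMap.mem_ker, hℓ, ← Matrix.sum_transpose_act_mul, hw]
      simp)
    -- Since `w` vanishes on the range of `B`, it is a functional on the image of `A`; the
    -- obstruction to extending it to all of `R^a` lies in `Ext^1(coker A, R) = 0`.
    obtain ⟨hex, hS⟩ := Matrix.coker_shortExact h
    obtain ⟨e, he⟩ := Ext.contravariant_sequence_exact₁ hS (Y := ModuleCat.of R R)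
      (Ext.mk₀ (ModuleCat.ofHom g)) (add_comm 1 0) (Subsingleton.elim _ _)
    obtain ⟨f, rfl⟩ := (Ext.mk₀_bijective _ _).2 e
    rw [Ext.mk₀_comp_mk₀] at he
    have he' := (Ext.mk₀_bijective _ _).1 he
    have h1 : ∀ v, f.hom (A.act R v) = ∑ j, w j * v j := fun v =>
      (congrArg (fun t => t.hom (Submodule.Quotient.mk v)) he').trans (hℓ v)
    refine ⟨fun i => f.hom (Pi.single i (1 : R)), funext fun j => ?_⟩
    have h2 := h1 (Pi.single j 1)
    rw [Matrix.act_single] at h2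
    have h3 : (fun i => A i j • (1 : R)) = ∑ i, A i j • (Pi.single i (1 : R) : Fin a → R) := by
      ext i
      simp [Finset.sum_apply, Pi.single_apply]
    rw [h3, map_sum] at h2
    rw [Matrix.act_apply]
    simp only [map_smul] at h2
    refine h2.trans ?_
    simp [Pi.single_apply]
  · rintro ⟨u, rfl⟩
    funext k
    have h1 := Matrix.sum_transpose_act_mul (A := B) (A.transpose.act R u) (Pi.single k 1)
    rw [Matrix.sum_transpose_act_mul (A := A), (h _).2 ⟨_, rfl⟩] at h1
    simpa [Pi.single_apply] using h1

end Covers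

/-! ### Free resolutions given by chosen covers -/

section FreeResolution

variable {R : Type u} [CommRing R] [IsNoetherianRing R]

/-- The rank of a free cover of the second component. -/
def coverRank (s : Σ n, Submodule R (Fin n → R)) : ℕ := (exists_matrix_range_eq s.2).choose

/-- A matrix whose range is the second component. -/
def coverMatrix (s : Σ n, Submodule R (Fin n → R)) : Matrix (Fin s.1) (Fin (coverRank s)) R :=
  (exists_matrix_range_eq s.2).choose_spec.choose

lemma range_coverMatrix (s : Σ n, Submodule R (Fin n → R)) :
    LinearMap.range ((coverMatrix s).act R) = s.2 :=
  (exists_matrix_range_eq s.2).choose_spec.choose_spec.1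

lemma exists_coverMatrix_act_eq_zero (s : Σ n, Submodule R (Fin n → R)) :
    ∃ w, (coverMatrix s).act R w = 0 ∧ ∀ r : R, r • w = 0 → r = 0 :=
  (exists_matrix_range_eq s.2).choose_spec.choose_spec.2

/-- The successive syzygies of a submodule of a finite free module. -/
def syzygy (s : Σ n, Submodule R (Fin n → R)) : ℕ → Σ n, Submodule R (Fin n → R)
  | 0 => s
  | i + 1 => ⟨coverRank (syzygy s i), LinearMap.ker ((coverMatrix (syzygy s i)).act R)⟩

/-- The matrices of a free resolution of the quotient of a finite free module by a submodule. -/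
def resMatrix (s : Σ n, Submodule R (Fin n → R)) (i : ℕ) :
    Matrix (Fin (syzygy s i).1) (Fin (syzygy s (i + 1)).1) R :=
  coverMatrix (syzygy s i)

lemma exact_resMatrix (s : Σ n, Submodule R (Fin n → R)) (i : ℕ) :
    Function.Exact ((resMatrix s (i + 1)).act R) ((resMatrix s i).act R) :=
  LinearMap.exact_iff.2 (range_coverMatrix (syzygy s (i + 1))).symm

end FreeResolution

/-! ### Splicing a free resolution with a dual one -/

section CompleteResolution

/-- A complex of free modules of finite rank over a Gorenstein local ring is a complete resolution
if its transpose is exact. -/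
lemma exact_act_of_exact_transpose {R : Type u} [CommRing R] [IsGorensteinLocalRing R]
    (rank : ℤ → ℕ) (mat : ∀ n, Matrix (Fin (rank (n + 1))) (Fin (rank n)) R)
    (h : ∀ n, Function.Exact ((mat (n + 1)).transpose.act R) ((mat n).transpose.act R)) (n : ℤ) :
    Function.Exact ((mat n).act R) ((mat (n + 1)).act R) := by
  obtain ⟨N, hN⟩ := exists_subsingleton_ext R
  -- The transposed complex never ends, so each of its cokernels is a `k`-th syzygy for every `k`.
  -- Finite injective dimension of `R` then kills all its positive `Ext` into `R`.
  have key : ∀ (k j : ℕ) (n : ℤ), N ≤ j + k →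
      Subsingleton (Ext (ModuleCat.of R (mat n).transpose.coker) (ModuleCat.of R R) (j + 1)) := by
    intro k
    induction k with
    | zero => exact fun j n hj => hN _ _ (by lia)
    | succ k ih =>
      intro j n hj
      obtain ⟨n, rfl⟩ : ∃ m, n = m + 1 := ⟨n - 1, by ring⟩
      exact Matrix.subsingleton_ext_coker (h n) (ih (j + 1) n (by lia))
  simpa only [Matrix.transpose_transpose] using
    Matrix.exact_transpose_act (h n) (key N 0 n (by lia))

variable {R : Type u} [CommRing R] [IsGorensteinLocalRing R]

/-- From some point on the dual of a free resolution is exact. -/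
lemma exact_transpose_resMatrix {N : ℕ} (hN : ∀ (X : ModuleCat.{u} R) (j : ℕ), N ≤ j →
    Subsingleton (Ext X (ModuleCat.of R R) j)) (s : Σ n, Submodule R (Fin n → R)) (i : ℕ)
    (hi : N ≤ i) : Function.Exact ((resMatrix s i).transpose.act R)
      ((resMatrix s (i + 1)).transpose.act R) := by
  have key : ∀ i j, N ≤ i + j → Subsingleton
      (Ext (ModuleCat.of R (resMatrix s i).coker) (ModuleCat.of R R) (j + 1)) := by
    intro i
    induction i with
    | zero => exact fun j hj => hN _ _ (by lia)
    | succ i ih =>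
      exact fun j hj => Matrix.subsingleton_ext_coker (exact_resMatrix s i) (ih (j + 1) (by lia))
  exact Matrix.exact_transpose_act (exact_resMatrix s i) (key i 0 (by lia))

/-- The ranks in the complex obtained by splicing the tail of a free resolution with the dual of
a free resolution of its dual. -/
def spliceRank (s : Σ n, Submodule R (Fin n → R)) (N : ℕ) : ℤ → ℕ
  | .ofNat i => (syzygy ⟨(syzygy s N).1, LinearMap.ker ((resMatrix s N).transpose.act R)⟩ i).1
  | .negSucc i => (syzygy s (N + i + 1)).1

/-- The tail of a free resolution spliced with the dual of a free resolution of its dual. -/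
def spliceMatrix (s : Σ n, Submodule R (Fin n → R)) (N : ℕ) :
    ∀ n, Matrix (Fin (spliceRank s N (n + 1))) (Fin (spliceRank s N n)) R
  | .ofNat i =>
    (resMatrix ⟨(syzygy s N).1, LinearMap.ker ((resMatrix s N).transpose.act R)⟩ i).transpose
  | .negSucc 0 => resMatrix s N
  | .negSucc (i + 1) => resMatrix s (N + i + 1)

/-- Transposed, the nonnegative part is itself a free resolution, and at the splice exactness is the
choice of the first cover. Only the negative part, a dualized resolution, needs the bound `N ≤ M`.
-/
lemma exact_transpose_spliceMatrix {N : ℕ} (hN : ∀ (X : ModuleCat.{u} R) (j : ℕ), N ≤ j →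
    Subsingleton (Ext X (ModuleCat.of R R) j)) (s : Σ n, Submodule R (Fin n → R)) (M : ℕ)
    (hM : N ≤ M) : ∀ n, Function.Exact ((spliceMatrix s M (n + 1)).transpose.act R)
      ((spliceMatrix s M n).transpose.act R)
  | .ofNat i => exact_resMatrix _ i
  | .negSucc 0 => LinearMap.exact_iff.2 (range_coverMatrix
      (⟨(syzygy s M).1, LinearMap.ker ((resMatrix s M).transpose.act R)⟩ :
        Σ n, Submodule R (Fin n → R))).symm
  | .negSucc 1 => exact_transpose_resMatrix hN s M hM
  | .negSucc (i + 2) => exact_transpose_resMatrix hN s (M + i + 1) (by lia)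

/-- The complete resolution obtained from a free resolution. -/
def spliceResolution {N : ℕ} (hN : ∀ (X : ModuleCat.{u} R) (j : ℕ), N ≤ j →
    Subsingleton (Ext X (ModuleCat.of R R) j)) (s : Σ n, Submodule R (Fin n → R)) (M : ℕ)
    (hM : N ≤ M) : CompleteResolution R where
  rank := spliceRank s M
  mat := spliceMatrix s M
  exact := exact_act_of_exact_transpose _ _ (exact_transpose_spliceMatrix hN s M hM)
  exact_transpose := exact_transpose_spliceMatrix hN s M hM

end CompleteResolution

section Existence

variable {R : Type u} [CommRing R] [IsGorensteinLocalRing R]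

/-- Over a Gorenstein local ring there is a complete resolution whose cocycles contain an element
with zero annihilator and are a high syzygy of a given finitely generated module. -/
lemma exists_completeResolution (s : Σ n, Submodule R (Fin n → R)) :
    ∃ P : CompleteResolution R, (∃ w : P.cocycles, ∀ r : R, r • w = 0 → r = 0) ∧
      ∀ (X : ModuleCat.{u} R) (m : ℕ),
        (∀ j, m ≤ j → Subsingleton (Ext X (ModuleCat.of R P.cocycles) j)) →
        ∃ m', ∀ j, m' ≤ j → Subsingleton (Ext X (ModuleCat.of R ((Fin s.1 → R) ⧸ s.2)) j) := by
  obtain ⟨N, hN⟩ := exists_subsingleton_ext R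
  -- Splicing at `N + 1` rather than `N` makes the cocycles the kernel of `resMatrix s N`, which
  -- contains a vector with zero annihilator.
  let P := spliceResolution hN s (N + 1) (Nat.le_succ N)
  have hcoc : LinearMap.ker ((P.mat 0).act R) = LinearMap.range ((resMatrix s (N + 1)).act R) :=
    LinearMap.exact_iff.1 (show Function.Exact ((resMatrix s (N + 1)).act R) ((P.mat 0).act R) from
      P.exact (Int.negSucc 0))
  have hrange : ∀ i, LinearMap.range ((resMatrix s (i + 1)).act R) =
      LinearMap.ker ((resMatrix s i).act R) :=
    fun i => (LinearMap.exact_iff.1 (exact_resMatrix s i)).symm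
  refine ⟨P, ?_, fun X m hm => ⟨max m N, ?_⟩⟩
  · obtain ⟨w, hw, hw'⟩ := exists_coverMatrix_act_eq_zero (syzygy s N)
    have hw1 : w ∈ LinearMap.ker ((P.mat 0).act R) := by
      rw [hcoc, hrange]
      exact hw
    exact ⟨⟨w, hw1⟩, fun r hr => hw' r (congrArg Subtype.val hr)⟩
  have hfree : ∀ n j, N ≤ j → Subsingleton (Ext X (ModuleCat.of R (Fin n → R)) j) :=
    fun n j hj => subsingleton_ext_pi (hN X j hj) n
  -- Vanishing in all large degrees passes from a syzygy to the preceding one, because `Ext^j(X, -)`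
  -- vanishes on free modules for `j ≥ N`.
  have key : ∀ i j, i ≤ N + 1 → max m N ≤ j → Subsingleton (Ext X
      (ModuleCat.of R (LinearMap.range ((resMatrix s (N + 1 - i)).act R))) j) := by
    intro i
    induction i with
    | zero =>
      intro j _ hj
      have h1 := hm j (by lia)
      change Subsingleton (Ext X (ModuleCat.of R (LinearMap.ker ((P.mat 0).act R))) j) at h1
      rw [hcoc] at h1
      exact h1
    | succ i ih =>
      intro j hi hj
      obtain ⟨k, hk⟩ : ∃ k, N + 1 - i = k + 1 := ⟨N - i, by lia⟩
      have h1 := ih (j + 1) (by lia) (by lia)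
      rw [hk, hrange] at h1
      rw [show N + 1 - (i + 1) = k by lia]
      let f := ((resMatrix s k).act R).rangeRestrict
      have hex : Function.Exact (LinearMap.ker ((resMatrix s k).act R)).subtype f := by
        rw [LinearMap.exact_iff, LinearMap.ker_rangeRestrict, Submodule.range_subtype]
      exact extTorsion_bot_iff.1 (ExtTorsion.right_of_succ
        (exactComplex_shortExact hex (Submodule.subtype_injective _)
          (LinearMap.surjective_rangeRestrict _))
        (extTorsion_of_subsingleton h1) (extTorsion_of_subsingleton (hfree _ j (by lia))))
  intro j hj
  have h1 := key (N + 1) (j + 1) le_rfl (by lia)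
  rw [Nat.sub_self] at h1
  have h2 : LinearMap.range ((resMatrix s 0).act R) = s.2 := range_coverMatrix s
  rw [h2] at h1
  have hex : Function.Exact s.2.subtype s.2.mkQ := LinearMap.exact_subtype_mkQ _
  exact extTorsion_bot_iff.1 (ExtTorsion.right_of_succ
    (exactComplex_shortExact hex (Submodule.subtype_injective _) (Submodule.mkQ_surjective _))
    (extTorsion_of_subsingleton h1) (extTorsion_of_subsingleton (hfree _ j (by lia))))

variable (R) in
/-- Over a Gorenstein local ring which is not regular there is a complete resolution whose cocycles
have infinite injective dimension and contain an element with zero annihilator. -/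
lemma exists_completeResolution_injectiveDimension_eq_top (hR : ¬ IsRegularLocalRing R) :
    ∃ P : CompleteResolution R, (∃ w : P.cocycles, ∀ r : R, r • w = 0 → r = 0) ∧
      injectiveDimension (ModuleCat.of R P.cocycles) = ⊤ := by
  let m : Submodule R R := IsLocalRing.maximalIdeal R
  let e : (Fin 1 → R) ≃ₗ[R] R := LinearEquiv.funUnique (Fin 1) R R
  obtain ⟨P, hw, hP⟩ := exists_completeResolution (R := R) ⟨1, Submodule.comap e.toLinearMap m⟩
  refine ⟨P, hw, ?_⟩
  by_contra h
  obtain ⟨n, hn⟩ := (injectiveDimension_ne_top_iff _).1 h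
  obtain ⟨j, hj⟩ := hP (ModuleCat.of R (IsLocalRing.ResidueField R)) (n + 1) fun j hj =>
    HasInjectiveDimensionLT.subsingleton _ (n + 1) j hj _
  have e' : ((Fin 1 → R) ⧸ Submodule.comap e.toLinearMap m) ≃ₗ[R] (R ⧸ m) :=
    Submodule.Quotient.equiv _ _ e (Submodule.map_comap_eq_of_surjective e.surjective m)
  exact hR (isRegularLocalRing_of_subsingleton_ext
    (subsingleton_ext_of_linearEquiv_right (hj j le_rfl) e'))

end Existence

namespace CompleteResolution

variable {R : Type u} [CommRing R] (P : CompleteResolution R)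

/-- The modules `Ext^j(X, -)` of the cocycles vanish in the range in which those of the ring do. -/
lemma subsingleton_ext_cocycles {X : ModuleCat.{u} R} {d : ℕ}
    (h : ∀ j < d, Subsingleton (Ext X (ModuleCat.of R R) j)) (j : ℕ) (hj : j < d) :
    Subsingleton (Ext X (ModuleCat.of R P.cocycles) j) := by
  -- Cocycles in all degrees are treated together: those in degree `n` are the kernel of a map from
  -- a free module onto those in degree `n + 1`, so raising `j` by one uses the next `n`.
  suffices key : ∀ (j : ℕ) (n : ℤ), j < d →
      Subsingleton (Ext X (ModuleCat.of R (LinearMap.ker ((P.mat n).act R))) j) from key j 0 hj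
  intro j
  have hfree : ∀ n j, j < d → Subsingleton (Ext X (ModuleCat.of R (Fin n → R)) j) :=
    fun n j hj => subsingleton_ext_pi (h j hj) n
  induction j with
  | zero =>
    intro n hj
    have h1 := subsingleton_ext_zero_iff.1 (hfree (P.rank n) 0 hj)
    refine subsingleton_ext_zero_iff.2 ⟨fun f g => LinearMap.ext fun x => Subtype.ext ?_⟩
    exact LinearMap.congr_fun (Subsingleton.elim
      ((LinearMap.ker ((P.mat n).act R)).subtype ∘ₗ (f : X →ₗ[R] LinearMap.ker ((P.mat n).act R)))
      ((LinearMap.ker ((P.mat n).act R)).subtype ∘ₗ g)) x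
  | succ j ih =>
    intro n hj
    have h1 := ih (n + 1) (by lia)
    rw [LinearMap.exact_iff.1 (P.exact n)] at h1
    have hex : Function.Exact (LinearMap.ker ((P.mat n).act R)).subtype
        ((P.mat n).act R).rangeRestrict := by
      rw [LinearMap.exact_iff, LinearMap.ker_rangeRestrict, Submodule.range_subtype]
    exact extTorsion_bot_iff.1 (ExtTorsion.left_succ
      (exactComplex_shortExact hex (Submodule.subtype_injective _)
        (LinearMap.surjective_rangeRestrict _))
      (extTorsion_of_subsingleton h1) (extTorsion_of_subsingleton (hfree _ _ hj)))

end CompleteResolution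

/-! ### Gorenstein and G-Gorenstein modules -/

section FullSupport

variable {R : Type u} [CommRing R] {M : Type u} [AddCommGroup M] [Module R M]

lemma mem_support_of_smul_eq_zero {w : M} (hw : ∀ r : R, r • w = 0 → r = 0) (p : PrimeSpectrum R) :
    p ∈ Module.support R M :=
  mem_support_of_annihilates p w fun r hr => hw r hr ▸ p.asIdeal.zero_mem

/-- The support of a module of full support as an ordered set. -/
def supportOrderIso (h : ∀ p, p ∈ Module.support R M) : Module.support R M ≃o PrimeSpectrum R :=
  (OrderIso.setCongr _ _ (Set.eq_univ_of_forall h)).trans OrderIso.Set.univ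

/-- Here full support is used: the filtration then depends on `R` alone, and the Cousin complex of
`M` can be compared with that of `R`. -/
lemma mem_heightFiltration_iff (h : ∀ p, p ∈ Module.support R M) (i : ℕ) (p : PrimeSpectrum R) :
    p ∈ (heightFiltration R M).carrier i ↔ (i : ℕ∞) ≤ Order.height p := by
  have h1 : moduleHeight R M ⟨p, h p⟩ = Order.height p :=
    (Order.height_orderIso (supportOrderIso h) ⟨p, h p⟩).symm
  exact ⟨fun ⟨_, hp⟩ => h1 ▸ hp, fun hp => ⟨h p, h1.symm ▸ hp⟩⟩

lemma supportDim_eq_ringKrullDim (h : ∀ p, p ∈ Module.support R M) :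
    Module.supportDim R M = ringKrullDim R :=
  Order.krullDim_eq_of_orderIso (supportOrderIso h)

lemma exists_carrier_eq_empty [IsLocalRing R] [IsNoetherianRing R] {F : SpecFiltration R}
    (hF : ∀ i p, p ∈ F.carrier i ↔ (i : ℕ∞) ≤ Order.height p) : ∃ n, F.carrier n = ∅ := by
  obtain ⟨d, hd⟩ := ENat.ne_top_iff_exists.1
    (Ideal.height_ne_top (IsLocalRing.maximalIdeal.isMaximal R).ne_top)
  refine ⟨d + 1, Set.eq_empty_of_forall_notMem fun p hp => ?_⟩
  have h1 := (hF _ p).1 hp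
  have h2 : Order.height p ≤ d := by
    rw [hd, ← PrimeSpectrum.height_eq_orderHeight]
    exact Ideal.height_mono (IsLocalRing.le_maximalIdeal p.2.ne_top)
  have h3 := h1.trans h2
  norm_cast at h3
  lia

end FullSupport

section InjectiveModules

variable {R : Type u} [CommRing R]

/-- Injective modules are Gorenstein injective. -/
lemma isGorensteinInjective_of_injective {N : ModuleCat.{u} R} (hN : Module.Injective R N) :
    IsGorensteinInjective R N := by
  -- The complex with all terms `N × N` and differential `(a, b) ↦ (b, 0)` is contractible, so it
  -- stays exact under every `Hom(I, -)`; its cocycles are a copy of `N`.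
  let d : (N × N) →ₗ[R] (N × N) := LinearMap.inl R N N ∘ₗ LinearMap.snd R N N
  have hd : ∀ v, d v = (v.2, 0) := fun v => rfl
  let E : CochainComplex (ModuleCat.{u} R) ℤ := CochainComplex.of (fun _ => ModuleCat.of R (N × N))
    (fun _ => ModuleCat.ofHom d) fun _ => ModuleCat.hom_ext (LinearMap.ext fun v => rfl)
  have hE : ∀ n, E.d n (n + 1) = ModuleCat.ofHom d := fun n =>
    CochainComplex.of_d (fun _ => ModuleCat.of R (N × N)) (fun _ => ModuleCat.ofHom d) n
  refine ⟨E, fun n => ?_, fun n => ?_, fun I _ n => ?_, ?_⟩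
  · refine (⟨fun X Y _ _ _ _ f hf g => ?_⟩ : Module.Injective R (N × N))
    obtain ⟨h₁, hh₁⟩ := hN.out f hf (LinearMap.fst R N N ∘ₗ g)
    obtain ⟨h₂, hh₂⟩ := hN.out f hf (LinearMap.snd R N N ∘ₗ g)
    exact ⟨h₁.prod h₂, fun x => Prod.ext (hh₁ x) (hh₂ x)⟩
  · rw [hE, hE]
    exact fun v => ⟨fun h => ⟨(0, v.1), Prod.ext rfl (congrArg Prod.fst h).symm⟩,
      by rintro ⟨w, rfl⟩; rfl⟩
  · rw [hE, hE]
    intro (f : I →ₗ[R] N × N)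
    constructor
    · intro h
      refine ⟨LinearMap.inr R N N ∘ₗ LinearMap.fst R N N ∘ₗ f, LinearMap.ext fun x => ?_⟩
      exact Prod.ext rfl (congrArg Prod.fst (LinearMap.congr_fun h x)).symm
    · rintro ⟨g, rfl⟩
      rfl
  · have h0 : LinearMap.ker (E.d 0 1).hom = LinearMap.ker d := by
      rw [show E.d 0 1 = ModuleCat.ofHom d from hE 0]
      rfl
    have h1 : LinearMap.range (LinearMap.inl R N N) = LinearMap.ker d := by
      ext v
      constructor
      · rintro ⟨x, rfl⟩
        rfl
      · exact fun h => ⟨v.1, Prod.ext rfl (congrArg Prod.fst h).symm⟩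
    exact ⟨(LinearEquiv.ofInjective _ LinearMap.inl_injective).trans
      (LinearEquiv.ofEq _ _ (h1.trans h0.symm))⟩

lemma IsGorensteinModule.isGGorensteinModule [IsNoetherianRing R] {M : ModuleCat.{u} R}
    (h : IsGorensteinModule R M) : IsGGorensteinModule R M :=
  ⟨h.finite, h.nontrivial, h.exact, fun i => isGorensteinInjective_of_injective (h.injective i)⟩

/-- A Gorenstein module of full support over a local ring has finite injective dimension. -/
lemma IsGorensteinModule.injectiveDimension_ne_top [IsNoetherianRing R] [IsLocalRing R]
    {M : ModuleCat.{u} R} (h : IsGorensteinModule R M) (hM : ∀ p, p ∈ Module.support R M) :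
    injectiveDimension M ≠ ⊤ := by
  obtain ⟨n, hn⟩ := exists_carrier_eq_empty (mem_heightFiltration_iff hM)
  have h1 := hasInjectiveDimensionLT_of_cousin hn ((cousinExact_iff _ _ _).1 h.exact) h.injective
  exact (injectiveDimension_ne_top_iff _).2 ⟨n, hasInjectiveDimensionLT_of_ge M n (n + 1) (by lia)⟩

end InjectiveModules

namespace CompleteResolution

variable {R : Type u} [CommRing R] [IsGorensteinLocalRing R] (P : CompleteResolution R)
  {F : SpecFiltration R}

/-- A complete resolution stays exact on the cosyzygies in the Cousin complex of the ring. -/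
lemma exactOn_cousinCoker (hF : ∀ i p, p ∈ F.carrier i ↔ (i : ℕ∞) ≤ Order.height p)
    (hR : Module.support R R ⊆ F.carrier 0) (i : ℕ) : P.ExactOn (cousinCoker F R hR i) := by
  obtain ⟨n, hn⟩ := exists_carrier_eq_empty hF
  -- Descending induction from the end of the Cousin complex, where the cosyzygy is zero; exactness
  -- on the injective term and on the next cosyzygy gives exactness on the present one.
  have key : ∀ k i, n ≤ i + k → P.ExactOn (cousinCoker F R hR i) := by
    intro k
    induction k with
    | zero =>
      intro i hi
      have : Subsingleton (cousinCoker F R hR i) := by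
        refine subsingleton_cousinCoker (Set.eq_empty_of_forall_notMem fun p hp => ?_)
        have h1 := (hF i p).1 hp
        have h2 : p ∈ F.carrier n := (hF n p).2 (le_trans (by exact_mod_cast hi) h1)
        rwa [hn] at h2
      exact fun m v => ⟨fun _ => ⟨0, Subsingleton.elim _ _⟩, fun _ => Subsingleton.elim _ _⟩
    | succ k ih =>
      intro i hi
      obtain ⟨-, -, hinj, hT⟩ := cousinCoker_ext hF hR i
      exact exactOn_of_shortExact hinj (cousinProj_surjective F R hR i)
        (exact_cousinCokerToTerm_cousinProj F R hR i) (exactOn_of_injective hT)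
        (ih (i + 1) (by lia))
  exact key n i (by lia)

/-- The Cousin complex of the cocycles of a complete resolution is exact with Gorenstein injective
terms. -/
lemma cousin_cocycles (hF : ∀ i p, p ∈ F.carrier i ↔ (i : ℕ∞) ≤ Order.height p)
    (hM : Module.support R P.cocycles ⊆ F.carrier 0) : CousinExact F P.cocycles hM ∧
      ∀ i, IsGorensteinInjective R (cousinTerm F P.cocycles hM i) := by
  have hR : Module.support R R ⊆ F.carrier 0 := fun p _ => (hF 0 p).2 (by simp)
  refine ⟨(cousinExact_iff _ _ _).2 fun i => ?_, fun i => ?_⟩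
  · obtain ⟨φ, ψ, hψ⟩ := exists_cousin_tensor hR hM i
    obtain ⟨-, -, hinj, -⟩ := cousinCoker_ext hF hR i
    have h1 := rTensor_injective (P.exactOn_cousinCoker hF hR i) hinj
    intro x y hxy
    obtain ⟨x, rfl⟩ := φ.surjective x
    obtain ⟨y, rfl⟩ := φ.surjective y
    rw [← hψ, ← hψ] at hxy
    rw [h1 (ψ.injective hxy)]
  · obtain ⟨φ, ψ, hψ⟩ := exists_cousin_tensor hR hM i
    exact P.isGorensteinInjective_tensor (cousinCoker_ext hF hR i).2.2.2 ψ

lemma isGGorensteinModule {w : P.cocycles} (hw : ∀ r : R, r • w = 0 → r = 0) :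
    IsGGorensteinModule R (ModuleCat.of R P.cocycles) := by
  have h := P.cousin_cocycles (mem_heightFiltration_iff (mem_support_of_smul_eq_zero hw))
    (support_subset_heightFiltration R P.cocycles)
  refine ⟨inferInstanceAs (Module.Finite R P.cocycles), ⟨w, 0, ?_⟩, h.1, h.2⟩
  rintro rfl
  exact one_ne_zero (hw 1 (smul_zero _))

/-- A regular sequence lowers the dimension by its length, so the depth is at most `d = dim R`. It
reaches `d` because `Ext^j(k, R)`, and with it `Ext^j(k, P.cocycles)`, vanishes for `j < d`. -/
lemma isMaximalCohenMacaulay {w : P.cocycles} (hw : ∀ r : R, r • w = 0 → r = 0) :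
    IsMaximalCohenMacaulay R (ModuleCat.of R P.cocycles) := by
  have hG := P.isGGorensteinModule hw
  have := hG.finite
  have := hG.nontrivial
  have hdim : Module.supportDim R (ModuleCat.of R P.cocycles) = ringKrullDim R :=
    supportDim_eq_ringKrullDim (mem_support_of_smul_eq_zero hw)
  refine ⟨hG.finite, hG.nontrivial, ?_, hdim⟩
  rw [hdim, ← IsLocalRing.maximalIdeal_height_eq_ringKrullDim]
  obtain ⟨d, hd⟩ := ENat.ne_top_iff_exists.1
    (Ideal.height_ne_top (IsLocalRing.maximalIdeal.isMaximal R).ne_top)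
  rw [← IsLocalRing.maximalIdeal_height_eq_ringKrullDim, ← hd] at hdim
  rw [← hd]
  refine congrArg _ (le_antisymm (iSup_le fun rs => ?_) ?_)
  · have h1 := Module.supportDim_add_length_eq_supportDim_of_isRegular rs.1 rs.2.2
    have hne := rs.2.2.quot_ofList_smul_nontrivial ⊤
    obtain ⟨e, he⟩ := WithBot.ne_bot_iff_exists.1 (Module.supportDim_ne_bot_of_nontrivial R
      (ModuleCat.of R P.cocycles ⧸ Ideal.ofList rs.1 •
        (⊤ : Submodule R (ModuleCat.of R P.cocycles))))
    rw [hdim, ← he] at h1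
    have h2 : e + (rs.1.length : ℕ∞) = d := WithBot.coe_injective h1
    exact le_of_le_of_eq le_add_self h2
  · obtain ⟨rs, hlen, hmem, hreg⟩ := ModuleCat.exists_isRegular_of_exists_subsingleton_ext
      (IsLocalRing.maximalIdeal R) d (ModuleCat.of R P.cocycles) (by
        exact (Submodule.top_ne_ideal_smul_of_le_jacobson_annihilator
          (IsLocalRing.maximalIdeal_le_jacobson _)).symm.lt_top)
      (ModuleCat.of R (R ⧸ IsLocalRing.maximalIdeal R)) (by
        rw [Module.support_eq_zeroLocus, Ideal.annihilator_quotient])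
      (P.subsingleton_ext_cocycles fun j hj => by
        refine subsingleton_ext_of_lt_height (IsLocalRing.closedPoint R) j ?_
        rw [← PrimeSpectrum.height_eq_orderHeight]
        exact lt_of_lt_of_eq (by exact_mod_cast hj) hd)
    exact le_iSup_of_le ⟨rs, hmem, hreg⟩ (by rw [hlen])

end CompleteResolution

end

theorem theorem3p11 (R : Type u) [CommRing R] [IsGorensteinLocalRing R]
    (hR : ¬ IsRegularLocalRing R) :
    {M : ModuleCat.{u} R | IsGorensteinModule R M} ⊂
        {M : ModuleCat.{u} R | IsGGorensteinModule R M} ∧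
      ∃ M : ModuleCat.{u} R, IsMaximalCohenMacaulay R M ∧ injectiveDimension M = ⊤ ∧
        IsGGorensteinModule R M ∧ ¬ IsGorensteinModule R M := by
  obtain ⟨P, ⟨w, hw⟩, hP⟩ := exists_completeResolution_injectiveDimension_eq_top R hR
  have h1 := P.isGGorensteinModule hw
  have h2 : ¬ IsGorensteinModule R (ModuleCat.of R P.cocycles) := fun h =>
    h.injectiveDimension_ne_top (mem_support_of_smul_eq_zero hw) hP
  exact ⟨(Set.ssubset_iff_of_subset fun M hM => hM.isGGorensteinModule).2 ⟨_, h1, h2⟩,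
    _, P.isMaximalCohenMacaulay hw, hP, h1, h2⟩
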